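/- Let $n\ge 2$ and let $B_1\subset\mathbb R^n$ be the open unit ball. Given a boundary datum $g\in W^{1,2}(B_1)$ and an obstacle $\phi\in W^{1,2}(B_1)$, a solution of the obstacle problem is a minimizer of $\int_{B_1}|\nabla w|^2$ among all $w\in W^{1,2}(B_1)$ with $w-g\in W^{1,2}_0(B_1)$ and $w\ge\phi$ almost everywhere in $B_1$. For a symmetric matrix $M=ODO^T$, with $O$ orthogonal and $D$ diagonal, let $M_+=OD_+O^T$, where $D_+$ is the entrywise positive part of $D$. There exist a Lipschitz obstacle $\phi$ on $B_1$, a datum $g\in W^{1,2}(B_1)$ and a solution $u$ of the obstacle problem with obstacle $\phi$ and boundary datum $g$ such that $u=\phi$, $u\in W^{2,1}(B_1)$, and $(D^2u)_+\notin L^p(B_1)$ for every $p>1$. -/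

import Mathlib

open MeasureTheory Filter Topology Metric
open scoped ENNReal NNReal ContDiff

attribute [local instance] Matrix.frobeniusNormedAddCommGroup

noncomputable section

namespace ObstacleProblem

variable {n : ℕ}

/-- Test functions on `Ω`: the smooth real functions whose support is a compact subset of `Ω`. -/
structure IsTestFunction (Ω : Set (EuclideanSpace ℝ (Fin n)))
    (ψ : EuclideanSpace ℝ (Fin n) → ℝ) : Prop where
  contDiff : ContDiff ℝ ∞ ψ
  hasCompactSupport : HasCompactSupport ψ
  tsupport_subset : tsupport ψ ⊆ Ω

/-- `h` is the weak (distributional) partial derivative `∂ᵢ f` on the open set `Ω`. -/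
structure HasWeakPartial (Ω : Set (EuclideanSpace ℝ (Fin n))) (i : Fin n)
    (f h : EuclideanSpace ℝ (Fin n) → ℝ) : Prop where
  locallyIntegrableOn : LocallyIntegrableOn f Ω volume
  locallyIntegrableOn_deriv : LocallyIntegrableOn h Ω volume
  integral_eq : ∀ ψ : EuclideanSpace ℝ (Fin n) → ℝ, IsTestFunction Ω ψ →
    ∫ x in Ω, f x * fderiv ℝ ψ x (EuclideanSpace.single i 1) = - ∫ x in Ω, h x * ψ x

/-- `G` is the weak gradient of `f` on `Ω`. -/
def IsWeakGradient (Ω : Set (EuclideanSpace ℝ (Fin n))) (f : EuclideanSpace ℝ (Fin n) → ℝ)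
    (G : EuclideanSpace ℝ (Fin n) → EuclideanSpace ℝ (Fin n)) : Prop :=
  ∀ i, HasWeakPartial Ω i f (fun x => G x i)

/-- `H` is the weak Hessian of `f` on `Ω`: the weak derivative of the weak gradient. -/
def IsWeakHessian (Ω : Set (EuclideanSpace ℝ (Fin n))) (f : EuclideanSpace ℝ (Fin n) → ℝ)
    (H : EuclideanSpace ℝ (Fin n) → Matrix (Fin n) (Fin n) ℝ) : Prop :=
  ∃ G : EuclideanSpace ℝ (Fin n) → EuclideanSpace ℝ (Fin n),
    IsWeakGradient Ω f G ∧ ∀ i j, HasWeakPartial Ω j (fun x => G x i) (fun x => H x i j)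

/-- The Sobolev space `W^{1,p}(Ω)`. -/
def MemW1 (p : ℝ≥0∞) (Ω : Set (EuclideanSpace ℝ (Fin n)))
    (f : EuclideanSpace ℝ (Fin n) → ℝ) : Prop :=
  MemLp f p (volume.restrict Ω) ∧
    ∃ G : EuclideanSpace ℝ (Fin n) → EuclideanSpace ℝ (Fin n),
      IsWeakGradient Ω f G ∧ MemLp G p (volume.restrict Ω)

/-- The Sobolev space `W^{2,p}(Ω)`. -/
def MemW2 (p : ℝ≥0∞) (Ω : Set (EuclideanSpace ℝ (Fin n)))
    (f : EuclideanSpace ℝ (Fin n) → ℝ) : Prop :=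
  MemW1 p Ω f ∧
    ∃ H : EuclideanSpace ℝ (Fin n) → Matrix (Fin n) (Fin n) ℝ,
      IsWeakHessian Ω f H ∧ MemLp H p (volume.restrict Ω)

/-- The space `W^{1,2}_0(Ω)`: the closure of the test functions in `W^{1,2}(Ω)`. -/
def MemW120 (Ω : Set (EuclideanSpace ℝ (Fin n))) (f : EuclideanSpace ℝ (Fin n) → ℝ) : Prop :=
  MemLp f 2 (volume.restrict Ω) ∧
    ∃ G : EuclideanSpace ℝ (Fin n) → EuclideanSpace ℝ (Fin n),
      IsWeakGradient Ω f G ∧ MemLp G 2 (volume.restrict Ω) ∧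
      ∃ ψ : ℕ → EuclideanSpace ℝ (Fin n) → ℝ,
        (∀ k, IsTestFunction Ω (ψ k)) ∧
        Tendsto (fun k => eLpNorm (fun x => f x - ψ k x) 2 (volume.restrict Ω)) atTop (𝓝 0) ∧
        Tendsto (fun k => eLpNorm (fun x => G x - gradient (ψ k) x) 2 (volume.restrict Ω))
          atTop (𝓝 0)

/-- The admissible class of the obstacle problem on `Ω` with obstacle `φ` and boundary datum `g`:
all `w ∈ W^{1,2}(Ω)` with `w - g ∈ W^{1,2}_0(Ω)` and `w ≥ φ` (almost everywhere) in `Ω`. -/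
structure IsAdmissible (Ω : Set (EuclideanSpace ℝ (Fin n)))
    (φ g w : EuclideanSpace ℝ (Fin n) → ℝ) : Prop where
  memW1 : MemW1 2 Ω w
  boundary : MemW120 Ω (fun x => w x - g x)
  above : ∀ᵐ x ∂(volume.restrict Ω), φ x ≤ w x

/-- `u` solves the obstacle problem on `Ω` with obstacle `φ ∈ W^{1,2}(Ω)` and boundary datum
`g ∈ W^{1,2}(Ω)`: it minimizes the Dirichlet energy `∫_Ω |∇w|²` in the admissible class. (The weak
gradient of a function in `W^{1,2}(Ω)` is determined up to a null set and square integrable.) -/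
structure IsObstacleSolution (Ω : Set (EuclideanSpace ℝ (Fin n)))
    (φ g u : EuclideanSpace ℝ (Fin n) → ℝ) : Prop where
  obstacle : MemW1 2 Ω φ
  datum : MemW1 2 Ω g
  admissible : IsAdmissible Ω φ g u
  minimal : ∀ w : EuclideanSpace ℝ (Fin n) → ℝ, IsAdmissible Ω φ g w →
    ∀ Gu Gw : EuclideanSpace ℝ (Fin n) → EuclideanSpace ℝ (Fin n),
      IsWeakGradient Ω u Gu → IsWeakGradient Ω w Gw →
      ∫ x in Ω, ‖Gu x‖ ^ 2 ≤ ∫ x in Ω, ‖Gw x‖ ^ 2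

/-- The positive part `M₊` of a symmetric matrix: `O D₊ Oᵀ` if `M = O D Oᵀ` with `O` orthogonal and
`D` diagonal, where `D₊` is the entrywise positive part. It is the functional calculus of
`t ↦ max t 0` (and takes the value `0` on matrices that are not symmetric). -/
def matrixPosPart (M : Matrix (Fin n) (Fin n) ℝ) : Matrix (Fin n) (Fin n) ℝ :=
  cfc (fun t : ℝ => max t 0) M

end ObstacleProblem

end

/-! The same function serves as obstacle, datum and solution. If `u` is weakly superharmonic, then
every competitor `w ≥ u` with `w - u` in `W^{1,2}_0` satisfies `∫ ∇u · ∇(w - u) ≥ 0`, and expanding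
the square shows that `u` has the least energy (`isObstacleSolution_of_series`). It remains to find
a Lipschitz superharmonic `u` in `W^{2,1}` with one pure second derivative so large that `(D²u)₊` is
in no `L^p`, `p > 1`.

The building block is `model s t = bump s * cos t - 7 * hull s`, where `bump s = 1 / (1 + s²)` and
`hull'' = bump`. The concave term `-7 hull` depends on `s` only: it makes the Laplacian nonpositive
without touching the oscillating second derivative `-bump s * cos t` in `t`. Put `u = ∑ (a_k / ν_k)
model(ν_k xᵢ, ν_k xⱼ)` with `a_k = 2^{-k}` and `ν_k = π n 2^{k²}`. The gradients of the terms are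
`O(a_k)`, so `u` is Lipschitz. The Hessians are `O(a_k ν_k bump(ν_k xᵢ))`, with `L¹` norm `O(a_k)`
on the ball, so `u` is in `W^{2,1}`.

For the negative statement, integrate `∂ⱼⱼu` against the weight `1 - cos(ν_m xⱼ)`, with values in
`[0, 2]`, over a slab of width about `1/ν_m` in the direction `i`. Orthogonality of cosines removes
every term except the `m`-th, which contributes at least `c · 2^{-m}` (`le_setIntegral_seriesHess`).
Since `∂ⱼⱼu ≤ ((D²u)₊)ⱼⱼ`, an `L^p` bound and Hölder's inequality would make this integral at most
`C (2^{-m²})^{1 - 1/p}`, which is smaller than `c · 2^{-m}` for a suitable `m`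
(`not_memLp_of_seriesHess_le`). -/

namespace ObstacleProblem

/-! ### Series of functions with summable `L¹` norms. -/

section IntegralSeries

variable {α : Type*} [MeasurableSpace α] {μ : Measure α}

theorem lintegral_enorm_eq_ofReal {f : α → ℝ} (hf : Integrable f μ) :
    ∫⁻ a, ‖f a‖ₑ ∂μ = ENNReal.ofReal (∫ a, |f a| ∂μ) := by
  rw [← ofReal_integral_norm_eq_lintegral_enorm hf]; rfl

theorem lintegral_tsum_enorm_lt_top {f : ℕ → α → ℝ} (hf : ∀ k, Integrable (f k) μ)
    (hs : Summable fun k => ∫ a, |f k a| ∂μ) : ∫⁻ a, ∑' k, ‖f k a‖ₑ ∂μ < ⊤ := by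
  rw [lintegral_tsum fun k => (hf k).1.enorm]
  simp_rw [fun k => lintegral_enorm_eq_ofReal (hf k)]
  rw [← ENNReal.ofReal_tsum_of_nonneg (fun k => integral_nonneg fun a => abs_nonneg _) hs]
  exact ENNReal.ofReal_lt_top

/-- The Hessian series of the construction diverges at some points; there `tsum` takes the default
value 0. This lemma confines such points to a null set. -/
theorem ae_summable_of_summable_integral {f : ℕ → α → ℝ} (hf : ∀ k, Integrable (f k) μ)
    (hs : Summable fun k => ∫ a, |f k a| ∂μ) : ∀ᵐ a ∂μ, Summable fun k => f k a := by
  have hmeas : AEMeasurable (fun a => ∑' k, ‖f k a‖ₑ) μ :=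
    AEMeasurable.tsum fun k => (hf k).1.enorm
  filter_upwards [ae_lt_top' hmeas (lintegral_tsum_enorm_lt_top hf hs).ne] with a ha
  have : Summable fun k => ‖f k a‖₊ := ENNReal.tsum_coe_ne_top_iff_summable.1 ha.ne
  exact Summable.of_norm (f := fun k => f k a) (NNReal.summable_coe.2 this)

theorem integrable_tsum_of_summable_integral {f : ℕ → α → ℝ} (hf : ∀ k, Integrable (f k) μ)
    (hs : Summable fun k => ∫ a, |f k a| ∂μ) : Integrable (fun a => ∑' k, f k a) μ := by
  refine ⟨?_, ?_⟩
  · refine aestronglyMeasurable_of_tendsto_ae atTop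
      (f := fun N a => ∑ k ∈ Finset.range N, f k a)
      (fun N => Finset.aestronglyMeasurable_fun_sum _ fun k _ => (hf k).1) ?_
    filter_upwards [ae_summable_of_summable_integral hf hs] with a ha
    exact ha.hasSum.tendsto_sum_nat
  · refine lt_of_le_of_lt (lintegral_mono fun a => ?_) (lintegral_tsum_enorm_lt_top hf hs)
    exact enorm_tsum_le_tsum_enorm

theorem hasSum_integral_mul_of_summable {f : ℕ → α → ℝ} (hf : ∀ k, Integrable (f k) μ)
    (hs : Summable fun k => ∫ a, |f k a| ∂μ) {ψ : α → ℝ} (hψ : AEStronglyMeasurable ψ μ)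
    {C : ℝ} (hC : ∀ a, |ψ a| ≤ C) :
    HasSum (fun k => ∫ a, f k a * ψ a ∂μ) (∫ a, (∑' k, f k a) * ψ a ∂μ) := by
  have h1 : ∀ k, Integrable (fun a => f k a * ψ a) μ := fun k =>
    (hf k).mul_bdd (c := C) hψ (ae_of_all _ hC)
  have h2 : Summable fun k => ∫ a, ‖f k a * ψ a‖ ∂μ := by
    refine Summable.of_nonneg_of_le (fun k => integral_nonneg fun a => norm_nonneg _)
      (fun k => ?_) (hs.mul_right C)
    rw [← integral_mul_const]
    refine integral_mono (h1 k).norm ((hf k).abs.mul_const C) fun a => ?_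
    simp only [norm_mul, Real.norm_eq_abs]
    exact mul_le_mul_of_nonneg_left (hC a) (abs_nonneg _)
  simpa only [tsum_mul_right] using hasSum_integral_of_summable_integral_norm h1 h2

end IntegralSeries

/-! ### Calculus of weak derivatives, and diagonal entries of the positive part. -/

section WeakDerivative

variable {n : ℕ} {Ω : Set (EuclideanSpace ℝ (Fin n))}

local notation "E" => EuclideanSpace ℝ (Fin n)

theorem IsTestFunction.continuous_partial {ψ : E → ℝ} (hψ : IsTestFunction Ω ψ) (v : E) :
    Continuous fun x => fderiv ℝ ψ x v :=
  (hψ.contDiff.continuous_fderiv (by simp)).clm_apply continuous_const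

theorem IsTestFunction.hasCompactSupport_partial {ψ : E → ℝ} (hψ : IsTestFunction Ω ψ) (v : E) :
    HasCompactSupport fun x => fderiv ℝ ψ x v :=
  hψ.hasCompactSupport.fderiv_apply (𝕜 := ℝ) v

theorem IsTestFunction.bound {ψ : E → ℝ} (hψ : IsTestFunction Ω ψ) : ∃ C, ∀ x, |ψ x| ≤ C :=
  hψ.hasCompactSupport.exists_bound_of_continuous hψ.contDiff.continuous

theorem IsTestFunction.bound_partial {ψ : E → ℝ} (hψ : IsTestFunction Ω ψ) (v : E) :
    ∃ C, ∀ x, |fderiv ℝ ψ x v| ≤ C :=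
  (hψ.hasCompactSupport_partial v).exists_bound_of_continuous (hψ.continuous_partial v)

theorem IsTestFunction.setIntegral_mul {ψ : E → ℝ} (hψ : IsTestFunction Ω ψ) (f : E → ℝ) :
    ∫ x in Ω, f x * ψ x = ∫ x, f x * ψ x := by
  refine setIntegral_eq_integral_of_forall_compl_eq_zero fun x hx => ?_
  rw [image_eq_zero_of_notMem_tsupport fun h => hx (hψ.tsupport_subset h), mul_zero]

theorem IsTestFunction.setIntegral_mul_partial {ψ : E → ℝ} (hψ : IsTestFunction Ω ψ)
    (f : E → ℝ) (v : E) :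
    ∫ x in Ω, f x * fderiv ℝ ψ x v = ∫ x, f x * fderiv ℝ ψ x v := by
  refine setIntegral_eq_integral_of_forall_compl_eq_zero fun x hx => ?_
  have : fderiv ℝ ψ x = 0 := image_eq_zero_of_notMem_tsupport
    fun h => hx (hψ.tsupport_subset (tsupport_fderiv_subset ℝ h))
  simp [this]

/-- A continuous classical partial derivative is a weak partial derivative. -/
theorem HasWeakPartial.of_hasLineDerivAt {i : Fin n} {f h : E → ℝ} (hf : Continuous f)
    (hh : Continuous h) (hd : ∀ x, HasLineDerivAt ℝ f (h x) x (EuclideanSpace.single i 1)) :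
    HasWeakPartial Ω i f h where
  locallyIntegrableOn := hf.locallyIntegrable.locallyIntegrableOn _
  locallyIntegrableOn_deriv := hh.locallyIntegrable.locallyIntegrableOn _
  integral_eq ψ hψ := by
    rw [hψ.setIntegral_mul, hψ.setIntegral_mul_partial]
    have hc := hψ.contDiff.continuous
    have hcs := hψ.hasCompactSupport
    exact integral_bilinear_hasLineDerivAt_right_eq_neg_left_of_integrable
      (B := ContinuousLinearMap.mul ℝ ℝ)
      ((hh.mul hc).integrable_of_hasCompactSupport hcs.mul_left)
      ((hf.mul (hψ.continuous_partial _)).integrable_of_hasCompactSupport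
        (hψ.hasCompactSupport_partial _).mul_left)
      ((hf.mul hc).integrable_of_hasCompactSupport hcs.mul_left)
      (fun x _ => hd x)
      (fun x _ => ((hψ.contDiff.differentiable (by simp)) x).hasFDerivAt.hasLineDerivAt _)

theorem integrable_mul_test {f ψ : E → ℝ} (hf : LocallyIntegrableOn f Ω volume)
    (hψ : IsTestFunction Ω ψ) : IntegrableOn (fun x => f x * ψ x) Ω volume := by
  have hK : IntegrableOn f (tsupport ψ) volume :=
    hf.integrableOn_compact_subset hψ.tsupport_subset hψ.hasCompactSupport
  obtain ⟨C, hC⟩ := hψ.bound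
  have h1 : IntegrableOn (fun x => f x * ψ x) (tsupport ψ) volume :=
    hK.mul_bdd (c := C) hψ.contDiff.continuous.aestronglyMeasurable (ae_of_all _ hC)
  refine (IntegrableOn.integrable_of_forall_notMem_eq_zero h1 fun x hx => ?_).integrableOn
  rw [image_eq_zero_of_notMem_tsupport hx, mul_zero]

/-- Weak partial derivatives are unique up to null sets. -/
theorem HasWeakPartial.ae_eq (hΩ : IsOpen Ω) {i : Fin n} {f f' h h' : E → ℝ}
    (H : HasWeakPartial Ω i f h) (H' : HasWeakPartial Ω i f' h')
    (hff : f =ᵐ[volume.restrict Ω] f') : h =ᵐ[volume.restrict Ω] h' := by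
  have key := hΩ.ae_eq_zero_of_integral_contDiff_smul_eq_zero
    (H.locallyIntegrableOn_deriv.sub H'.locallyIntegrableOn_deriv) (μ := volume) (fun ψ h1 h2 h3 => by
      have hψ : IsTestFunction Ω ψ := ⟨h1, h2, h3⟩
      have e1 := H.integral_eq ψ hψ
      have e2 := H'.integral_eq ψ hψ
      have e3 : ∫ x in Ω, f x * fderiv ℝ ψ x (EuclideanSpace.single i 1)
          = ∫ x in Ω, f' x * fderiv ℝ ψ x (EuclideanSpace.single i 1) :=
        integral_congr_ae (hff.mono fun x hx => by simp only [hx])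
      have e4 : ∫ x, ψ x • (h - h') x = ∫ x in Ω, (h x * ψ x - h' x * ψ x) := by
        rw [← setIntegral_eq_integral_of_forall_compl_eq_zero (s := Ω)]
        · exact integral_congr_ae (ae_of_all _ fun x => by simp; ring)
        · intro x hx
          rw [image_eq_zero_of_notMem_tsupport fun h => hx (h3 h), zero_smul]
      rw [e4, integral_sub (integrable_mul_test H.locallyIntegrableOn_deriv hψ)
        (integrable_mul_test H'.locallyIntegrableOn_deriv hψ)]
      linarith)
  rw [EventuallyEq, ae_restrict_iff' hΩ.measurableSet]
  exact key.mono fun x hx hxΩ => sub_eq_zero.1 (hx hxΩ)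

theorem IsWeakGradient.ae_eq (hΩ : IsOpen Ω) {f : E → ℝ} {G G' : E → E}
    (H : IsWeakGradient Ω f G) (H' : IsWeakGradient Ω f G') : G =ᵐ[volume.restrict Ω] G' := by
  have : ∀ᵐ x ∂(volume.restrict Ω), ∀ i, G x i = G' x i :=
    ae_all_iff.2 fun i => (H i).ae_eq hΩ (H' i) EventuallyEq.rfl
  exact this.mono fun x hx => by ext i; exact hx i

/-- Reduces a claim about every weak Hessian to the one given by the explicit series. -/
theorem IsWeakHessian.ae_eq (hΩ : IsOpen Ω) {f : E → ℝ} {H H' : E → Matrix (Fin n) (Fin n) ℝ}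
    (hH : IsWeakHessian Ω f H) (hH' : IsWeakHessian Ω f H') : H =ᵐ[volume.restrict Ω] H' := by
  obtain ⟨G, hG, hGH⟩ := hH
  obtain ⟨G', hG', hGH'⟩ := hH'
  have hGG := hG.ae_eq hΩ hG'
  have : ∀ᵐ x ∂(volume.restrict Ω), ∀ i j, H x i j = H' x i j :=
    ae_all_iff.2 fun i => ae_all_iff.2 fun j =>
      (hGH i j).ae_eq hΩ (hGH' i j) (hGG.mono fun x hx => by simp only [hx])
  exact this.mono fun x hx => by ext i j; exact hx i j

theorem HasWeakPartial.sub {i : Fin n} {f f' h h' : E → ℝ}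
    (H : HasWeakPartial Ω i f h) (H' : HasWeakPartial Ω i f' h') :
    HasWeakPartial Ω i (fun x => f x - f' x) (fun x => h x - h' x) where
  locallyIntegrableOn := H.locallyIntegrableOn.sub H'.locallyIntegrableOn
  locallyIntegrableOn_deriv := H.locallyIntegrableOn_deriv.sub H'.locallyIntegrableOn_deriv
  integral_eq ψ hψ := by
    have hp : IsTestFunction Ω fun x => fderiv ℝ ψ x (EuclideanSpace.single i 1) :=
      ⟨(hψ.contDiff.fderiv_right (m := ∞) (by simp)).clm_apply contDiff_const,
        hψ.hasCompactSupport_partial _,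
        (tsupport_fderiv_apply_subset ℝ _).trans hψ.tsupport_subset⟩
    simp only [sub_mul]
    rw [integral_sub (integrable_mul_test H.locallyIntegrableOn hp)
        (integrable_mul_test H'.locallyIntegrableOn hp),
      integral_sub (integrable_mul_test H.locallyIntegrableOn_deriv hψ)
        (integrable_mul_test H'.locallyIntegrableOn_deriv hψ),
      H.integral_eq ψ hψ, H'.integral_eq ψ hψ]
    ring

theorem IsWeakGradient.sub {f f' : E → ℝ} {G G' : E → E}
    (H : IsWeakGradient Ω f G) (H' : IsWeakGradient Ω f' G') :
    IsWeakGradient Ω (fun x => f x - f' x) (fun x => G x - G' x) :=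
  fun i => (H i).sub (H' i)

/-- Weak partial derivatives commute with series that converge absolutely in `L¹`. -/
theorem HasWeakPartial.tsum {i : Fin n} {f h : ℕ → E → ℝ}
    (H : ∀ k, HasWeakPartial Ω i (f k) (h k))
    (hf : ∀ k, IntegrableOn (f k) Ω volume) (hh : ∀ k, IntegrableOn (h k) Ω volume)
    (sf : Summable fun k => ∫ x in Ω, |f k x|) (sh : Summable fun k => ∫ x in Ω, |h k x|) :
    HasWeakPartial Ω i (fun x => ∑' k, f k x) (fun x => ∑' k, h k x) where
  locallyIntegrableOn :=
    IntegrableOn.locallyIntegrableOn (integrable_tsum_of_summable_integral hf sf)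
  locallyIntegrableOn_deriv :=
    IntegrableOn.locallyIntegrableOn (integrable_tsum_of_summable_integral hh sh)
  integral_eq ψ hψ := by
    obtain ⟨C, hC⟩ := hψ.bound
    obtain ⟨C', hC'⟩ := hψ.bound_partial (EuclideanSpace.single i 1)
    have h1 := hasSum_integral_mul_of_summable hf sf
      (hψ.continuous_partial (EuclideanSpace.single i 1)).aestronglyMeasurable hC'
    have h2 := (hasSum_integral_mul_of_summable hh sh
      hψ.contDiff.continuous.aestronglyMeasurable hC).neg
    refine h1.unique ?_
    simpa only [fun k => (H k).integral_eq ψ hψ] using h2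

theorem isTestFunction_zero : IsTestFunction Ω (fun _ : E => (0 : ℝ)) :=
  ⟨contDiff_const, HasCompactSupport.zero, by simp [tsupport, Function.support]⟩

theorem isWeakGradient_zero : IsWeakGradient Ω (fun _ : E => (0 : ℝ)) (fun _ => 0) := fun i =>
  HasWeakPartial.of_hasLineDerivAt continuous_const (by simpa using continuous_const)
    fun x => by simpa using (hasFDerivAt_const (0 : ℝ) x).hasLineDerivAt _

theorem memW120_zero : MemW120 Ω (fun _ : E => (0 : ℝ)) := by
  refine ⟨MemLp.zero', fun _ => 0, isWeakGradient_zero, MemLp.zero', fun _ _ => 0,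
    fun _ => isTestFunction_zero, by simp, by simp⟩

theorem memLp_euclidean {p : ℝ≥0∞} {μ : Measure E} {G : E → E}
    (h : ∀ i, MemLp (fun x => G x i) p μ) : MemLp G p μ := by
  have : G = fun x => ∑ i, G x i • (EuclideanSpace.single i 1 : E) := by
    ext x j; simp [Finset.sum_apply, Pi.single_apply]
  rw [this]
  exact memLp_finsetSum _ fun i _ =>
    ((ContinuousLinearMap.id ℝ ℝ).smulRight (EuclideanSpace.single i 1 : E)).comp_memLp' (h i)

attribute [local instance] Matrix.frobeniusNormedSpace

theorem memLp_matrix {p : ℝ≥0∞} {μ : Measure E} {H : E → Matrix (Fin n) (Fin n) ℝ}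
    (h : ∀ i j, MemLp (fun x => H x i j) p μ) : MemLp H p μ := by
  have : H = fun x => ∑ i, ∑ j, H x i j • (Matrix.single i j 1 : Matrix (Fin n) (Fin n) ℝ) := by
    ext x i j
    simp only [Matrix.smul_single, smul_eq_mul, mul_one]
    rw [← Matrix.matrix_eq_sum_single]
  rw [this]
  exact memLp_finsetSum _ fun i _ => memLp_finsetSum _ fun j _ =>
    ((ContinuousLinearMap.id ℝ ℝ).smulRight
      (Matrix.single i j 1 : Matrix (Fin n) (Fin n) ℝ)).comp_memLp' (h i j)

theorem memLp_matrix_apply {p : ℝ≥0∞} {μ : Measure E} {H : E → Matrix (Fin n) (Fin n) ℝ}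
    (h : MemLp H p μ) (i j : Fin n) : MemLp (fun x => H x i j) p μ :=
  (LinearMap.toContinuousLinearMap (Matrix.entryLinearMap ℝ ℝ i j)).comp_memLp' h

/-- `M₊ - M` is the functional calculus of `max t 0 - t ≥ 0`, hence positive semidefinite, and its
diagonal is nonnegative. -/
theorem le_matrixPosPart_apply {M : Matrix (Fin n) (Fin n) ℝ} (hM : M.IsHermitian) (i : Fin n) :
    M i i ≤ matrixPosPart M i i := by
  open scoped MatrixOrder in
  have h : 0 ≤ cfc (fun t : ℝ => max t 0 - t) M :=
    cfc_nonneg fun x _ => sub_nonneg.2 (le_max_left x 0)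
  rw [cfc_sub (fun t : ℝ => max t 0) (fun t => t) M (by fun_prop) (by fun_prop),
    show cfc (fun t : ℝ => t) M = M from cfc_id' ℝ M hM.isSelfAdjoint] at h
  have := (Matrix.nonneg_iff_posSemidef.1 h).diag_nonneg (i := i)
  simpa [matrixPosPart] using this

end WeakDerivative

/-! ### Limits and series of integrals with bounded factors. -/

section BoundedSeries

variable {α : Type*} [MeasurableSpace α] {μ : Measure α}

/-- On a finite measure space `L²` convergence implies `L¹` convergence, which survives
multiplication by a bounded function. It carries integration by parts from test functions to
`W^{1,2}_0`. -/
theorem tendsto_integral_mul_of_tendsto_eLpNorm [IsFiniteMeasure μ] {f X : α → ℝ} {Y : ℕ → α → ℝ}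
    (hf : AEStronglyMeasurable f μ) {C : ℝ} (hC : ∀ a, |f a| ≤ C) (hX : MemLp X 2 μ)
    (hY : ∀ k, MemLp (Y k) 2 μ) (hXY : Tendsto (fun k => eLpNorm (X - Y k) 2 μ) atTop (𝓝 0)) :
    Tendsto (fun k => ∫ a, f a * Y k a ∂μ) atTop (𝓝 (∫ a, f a * X a ∂μ)) := by
  have h12 : (1 : ℝ≥0∞) ≤ 2 := one_le_two
  refine tendsto_integral_of_L1' _ (hf.mul hX.1)
    (Eventually.of_forall fun k => ((hY k).integrable h12).bdd_mul hf (ae_of_all _ hC)) ?_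
  have hlim : Tendsto (fun k => ENNReal.ofReal C * (eLpNorm (X - Y k) 2 μ *
      μ Set.univ ^ (1 / (1 : ℝ≥0∞).toReal - 1 / (2 : ℝ≥0∞).toReal))) atTop (𝓝 0) := by
    have hfin : μ Set.univ ^ (1 / (1 : ℝ≥0∞).toReal - 1 / (2 : ℝ≥0∞).toReal) ≠ ⊤ :=
      ENNReal.rpow_ne_top_of_nonneg (by norm_num) (measure_ne_top _ _)
    have h1 := ENNReal.Tendsto.mul_const hXY (Or.inr hfin)
    have h2 := ENNReal.Tendsto.const_mul h1 (Or.inr (ENNReal.ofReal_ne_top (r := C)))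
    simpa using h2
  refine tendsto_of_tendsto_of_tendsto_of_le_of_le tendsto_const_nhds hlim
    (fun k => zero_le) fun k => ?_
  have h1 : eLpNorm ((fun a => f a * Y k a) - fun a => f a * X a) 1 μ
      ≤ ENNReal.ofReal C * eLpNorm (X - Y k) 1 μ := by
    refine eLpNorm_le_mul_eLpNorm_of_ae_le_mul (ae_of_all _ fun a => ?_) 1
    simp only [Pi.sub_apply, Real.norm_eq_abs, ← mul_sub, abs_mul, abs_sub_comm (Y k a)]
    exact mul_le_mul_of_nonneg_right (hC a) (abs_nonneg _)
  refine h1.trans ?_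
  gcongr
  exact eLpNorm_le_eLpNorm_mul_rpow_measure_univ h12 (hX.1.sub (hY k).1)

/-- Counterpart of `hasSum_integral_mul_of_summable` with the roles exchanged: the series is
dominated uniformly, and the fixed factor is merely integrable. -/
theorem hasSum_integral_mul_of_bounded {F : ℕ → α → ℝ} (hF : ∀ k, AEStronglyMeasurable (F k) μ)
    {c : ℕ → ℝ} (hc : Summable c) (hFc : ∀ k a, |F k a| ≤ c k) {g : α → ℝ} (hg : Integrable g μ) :
    HasSum (fun k => ∫ a, F k a * g a ∂μ) (∫ a, (∑' k, F k a) * g a ∂μ) := by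
  have h1 : ∀ k, Integrable (fun a => F k a * g a) μ := fun k =>
    hg.bdd_mul (hF k) (ae_of_all _ (hFc k))
  have h2 : Summable fun k => ∫ a, ‖F k a * g a‖ ∂μ := by
    refine Summable.of_nonneg_of_le (fun k => integral_nonneg fun a => norm_nonneg _)
      (fun k => ?_) (hc.mul_right (∫ a, |g a| ∂μ))
    rw [← integral_const_mul]
    refine integral_mono (h1 k).norm (hg.abs.const_mul _) fun a => ?_
    simp only [norm_mul, Real.norm_eq_abs]
    exact mul_le_mul_of_nonneg_right (hFc k a) (abs_nonneg _)
  simpa only [tsum_mul_right] using hasSum_integral_of_summable_integral_norm h1 h2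

end BoundedSeries

/-! ### Superharmonicity implies minimality. -/

section Minimality

variable {n : ℕ} {Ω : Set (EuclideanSpace ℝ (Fin n))}

local notation "E" => EuclideanSpace ℝ (Fin n)

theorem gradient_apply (ψ : E → ℝ) (x : E) (i : Fin n) :
    gradient ψ x i = fderiv ℝ ψ x (EuclideanSpace.single i 1) := by
  rw [← inner_gradient_left, EuclideanSpace.inner_single_right]
  simp

theorem IsTestFunction.memLp_two {ψ : E → ℝ} (hψ : IsTestFunction Ω ψ) (μ : Measure E)
    [IsFiniteMeasure μ] : MemLp ψ 2 μ := by
  obtain ⟨C, hC⟩ := hψ.bound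
  exact MemLp.of_bound hψ.contDiff.continuous.aestronglyMeasurable C (ae_of_all _ hC)

theorem IsTestFunction.memLp_two_partial {ψ : E → ℝ} (hψ : IsTestFunction Ω ψ) (v : E)
    (μ : Measure E) [IsFiniteMeasure μ] : MemLp (fun x => fderiv ℝ ψ x v) 2 μ := by
  obtain ⟨C, hC⟩ := hψ.bound_partial v
  exact MemLp.of_bound (hψ.continuous_partial v).aestronglyMeasurable C (ae_of_all _ hC)

/-- A bounded field with bounded nonpositive divergence has a nonnegative pairing with the gradient
of every nonnegative function of `W^{1,2}_0`. -/
theorem integral_field_mul_gradient_nonneg [IsFiniteMeasure (volume.restrict Ω)]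
    {F d : Fin n → E → ℝ} (hF : ∀ i, HasWeakPartial Ω i (F i) (d i))
    (mF : ∀ i, AEStronglyMeasurable (F i) (volume.restrict Ω))
    (md : ∀ i, AEStronglyMeasurable (d i) (volume.restrict Ω))
    {C C' : ℝ} (hC : ∀ i x, |F i x| ≤ C) (hC' : ∀ i x, |d i x| ≤ C')
    (hd : ∀ x, ∑ i, d i x ≤ 0) {V : E → ℝ} {G : E → E} (hV : MemLp V 2 (volume.restrict Ω))
    (hG : MemLp G 2 (volume.restrict Ω)) {ψ : ℕ → E → ℝ} (hψ : ∀ k, IsTestFunction Ω (ψ k))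
    (hVψ : Tendsto (fun k => eLpNorm (fun x => V x - ψ k x) 2 (volume.restrict Ω)) atTop (𝓝 0))
    (hGψ : Tendsto (fun k => eLpNorm (fun x => G x - gradient (ψ k) x) 2 (volume.restrict Ω))
      atTop (𝓝 0)) (hV0 : ∀ᵐ x ∂(volume.restrict Ω), 0 ≤ V x) :
    0 ≤ ∑ i, ∫ x in Ω, F i x * G x i := by
  set μ := (volume : Measure E).restrict Ω
  have hGi : ∀ i, MemLp (fun x => G x i) 2 μ := fun i =>
    (EuclideanSpace.proj i : E →L[ℝ] ℝ).comp_memLp' hG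
  have h1 : ∀ i, Tendsto (fun k => ∫ x, F i x * fderiv ℝ (ψ k) x (EuclideanSpace.single i 1) ∂μ)
      atTop (𝓝 (∫ x, F i x * G x i ∂μ)) := fun i => by
    refine tendsto_integral_mul_of_tendsto_eLpNorm (mF i) (hC i) (hGi i)
      (fun k => (hψ k).memLp_two_partial _ μ) ?_
    refine tendsto_of_tendsto_of_tendsto_of_le_of_le tendsto_const_nhds hGψ
      (fun k => zero_le) fun k => eLpNorm_mono fun x => ?_
    have := PiLp.norm_apply_le (G x - gradient (ψ k) x) i
    simpa [gradient_apply] using this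
  have h2 : ∀ i, Tendsto (fun k => ∫ x, d i x * ψ k x ∂μ) atTop (𝓝 (∫ x, d i x * V x ∂μ)) :=
    fun i => tendsto_integral_mul_of_tendsto_eLpNorm (md i) (hC' i) hV
      (fun k => (hψ k).memLp_two μ) hVψ
  have h3 : ∀ i, ∫ x, F i x * G x i ∂μ = - ∫ x, d i x * V x ∂μ := fun i =>
    tendsto_nhds_unique (h1 i) 
      ((h2 i).neg.congr fun k => ((hF i).integral_eq (ψ k) (hψ k)).symm)
  simp only [h3, Finset.sum_neg_distrib]
  rw [← integral_finsetSum _ fun i _ =>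
    (hV.integrable one_le_two).bdd_mul (md i) (ae_of_all _ (hC' i)), neg_nonneg]
  -- The sign is needed only for the limit `V`, so the approximating `ψ k` may change sign.
  refine integral_nonpos_of_ae (hV0.mono fun x hx => ?_)
  simp only [Pi.zero_apply, ← Finset.sum_mul]
  exact mul_nonpos_of_nonpos_of_nonneg (hd x) hx

/-- If the weak gradient of `u` is a uniformly convergent series of bounded fields with bounded
nonpositive divergences, then `u` solves the obstacle problem whose obstacle and datum are `u`. -/
theorem isObstacleSolution_of_series (hΩ : IsOpen Ω) [IsFiniteMeasure (volume.restrict Ω)]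
    {u : E → ℝ} {Gu : E → E} {F d : ℕ → Fin n → E → ℝ} (hu : MemLp u 2 (volume.restrict Ω))
    (hGu : IsWeakGradient Ω u Gu) (hGu2 : MemLp Gu 2 (volume.restrict Ω))
    (hF : ∀ k i, HasWeakPartial Ω i (F k i) (d k i))
    (mF : ∀ k i, AEStronglyMeasurable (F k i) (volume.restrict Ω))
    (md : ∀ k i, AEStronglyMeasurable (d k i) (volume.restrict Ω))
    {c c' : ℕ → ℝ} (hc : Summable c) (hFc : ∀ k i x, |F k i x| ≤ c k)
    (hdc : ∀ k i x, |d k i x| ≤ c' k) (hd : ∀ k x, ∑ i, d k i x ≤ 0)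
    (hGF : ∀ i x, Gu x i = ∑' k, F k i x) : IsObstacleSolution Ω u u u where
  obstacle := ⟨hu, Gu, hGu, hGu2⟩
  datum := ⟨hu, Gu, hGu, hGu2⟩
  admissible :=
    { memW1 := ⟨hu, Gu, hGu, hGu2⟩
      boundary := by simpa using memW120_zero (Ω := Ω)
      above := ae_of_all _ fun _ => le_rfl }
  minimal w hw Gu' Gw' hGu' hGw' := by
    obtain ⟨-, Gw, hGw, hGw2⟩ := hw.memW1
    obtain ⟨hV, G, hG, hG2, ψ, hψ, hVψ, hGψ⟩ := hw.boundary
    have eu := hGu'.ae_eq hΩ hGu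
    have ew := hGw'.ae_eq hΩ hGw
    have eG := hG.ae_eq hΩ (hGw.sub hGu)
    have hGi : ∀ i, MemLp (fun x => G x i) 2 (volume.restrict Ω) := fun i =>
      (EuclideanSpace.proj i : E →L[ℝ] ℝ).comp_memLp' hG2
    have hGui : ∀ i, MemLp (fun x => Gu x i) 2 (volume.restrict Ω) := fun i =>
      (EuclideanSpace.proj i : E →L[ℝ] ℝ).comp_memLp' hGu2
    have hsum : HasSum (fun k => ∑ i, ∫ x in Ω, F k i x * G x i)
        (∑ i, ∫ x in Ω, Gu x i * G x i) := by
      refine hasSum_sum fun i _ => ?_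
      simp only [hGF]
      exact hasSum_integral_mul_of_bounded (fun k => mF k i) hc (fun k => hFc k i)
        ((hGi i).integrable one_le_two)
    -- The sign is obtained for each `k` separately and then summed: the divergence bounds `c' k`
    -- need not be summable, so the full gradient need not have bounded divergence.
    have hnn : 0 ≤ ∑ i, ∫ x in Ω, Gu x i * G x i := hsum.nonneg fun k =>
      integral_field_mul_gradient_nonneg (hF k) (mF k) (md k) (hFc k) (hdc k) (hd k) hV hG2 hψ
        hVψ hGψ (hw.above.mono fun x hx => sub_nonneg.2 hx)
    have hint : ∀ i, Integrable (fun x => Gu x i * G x i) (volume.restrict Ω) := fun i =>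
      (hGui i).integrable_mul (hGi i)
    rw [← integral_finsetSum _ fun i _ => hint i] at hnn
    have hu2 : Integrable (fun x => ‖Gu x‖ ^ 2) (volume.restrict Ω) :=
      (memLp_two_iff_integrable_sq_norm hGu2.1).1 hGu2
    have hw2 : Integrable (fun x => ‖Gw x‖ ^ 2) (volume.restrict Ω) :=
      (memLp_two_iff_integrable_sq_norm hGw2.1).1 hGw2
    -- Expand `|∇w|² = |∇u|² + 2 ∇u · (∇w - ∇u) + |∇w - ∇u|²`, drop the last square, and use that
    -- the cross term has nonnegative integral.
    calc ∫ x in Ω, ‖Gu' x‖ ^ 2 = ∫ x in Ω, ‖Gu x‖ ^ 2 :=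
          integral_congr_ae (eu.mono fun x hx => by simp only [hx])
      _ ≤ (∫ x in Ω, ‖Gu x‖ ^ 2) + 2 * ∫ x in Ω, ∑ i, Gu x i * G x i := by linarith
      _ = ∫ x in Ω, (‖Gu x‖ ^ 2 + 2 * ∑ i, Gu x i * G x i) := by
          rw [integral_add hu2 ((integrable_finsetSum _ fun i _ => hint i).const_mul 2),
            integral_const_mul]
      _ ≤ ∫ x in Ω, ‖Gw x‖ ^ 2 := by
          refine integral_mono_ae
            (hu2.add ((integrable_finsetSum _ fun i _ => hint i).const_mul 2)) hw2
            (eG.mono fun x hx => ?_)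
          have h1 : ∑ i, Gu x i * G x i = inner ℝ (Gu x) (Gw x - Gu x) := by
            rw [hx, PiLp.inner_apply]
            simp [mul_comm]
          have h2 : ‖Gw x‖ ^ 2 = ‖Gu x + (Gw x - Gu x)‖ ^ 2 := by rw [add_sub_cancel]
          rw [norm_add_sq_real] at h2
          simp only [h1, h2]
          linarith [sq_nonneg ‖Gw x - Gu x‖]
      _ = ∫ x in Ω, ‖Gw' x‖ ^ 2 :=
          (integral_congr_ae (ew.mono fun x hx => by simp only [hx])).symm

end Minimality

end ObstacleProblem

noncomputable section

namespace ObstacleProblem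

/-! ### The superharmonic model in two variables. -/

namespace Oscillation

/-- The Cauchy profile `1 / (1 + s²)`. -/
def bump (s : ℝ) : ℝ := (1 + s ^ 2)⁻¹

/-- The derivative of `bump`. -/
def bumpDeriv (s : ℝ) : ℝ := -(2 * s) * bump s ^ 2

/-- The second derivative of `bump`. -/
def bumpDeriv₂ (s : ℝ) : ℝ := (6 * s ^ 2 - 2) * bump s ^ 3

/-- The second primitive of `bump`. -/
def hull (s : ℝ) : ℝ := s * Real.arctan s - Real.log (1 + s ^ 2) / 2

theorem one_add_sq_pos (s : ℝ) : 0 < 1 + s ^ 2 := by positivity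

theorem bump_pos (s : ℝ) : 0 < bump s := inv_pos.2 (one_add_sq_pos s)

theorem bump_le_one (s : ℝ) : bump s ≤ 1 := inv_le_one_of_one_le₀ (by nlinarith [sq_nonneg s])

theorem one_add_sq_mul_bump (s : ℝ) : (1 + s ^ 2) * bump s = 1 :=
  mul_inv_cancel₀ (one_add_sq_pos s).ne'

theorem continuous_bump : Continuous bump :=
  Continuous.inv₀ (by fun_prop) fun s => (one_add_sq_pos s).ne'

theorem continuous_bumpDeriv : Continuous bumpDeriv := by
  unfold bumpDeriv; have := continuous_bump; fun_prop

theorem continuous_bumpDeriv₂ : Continuous bumpDeriv₂ := by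
  unfold bumpDeriv₂; have := continuous_bump; fun_prop

theorem hasDerivAt_bump (s : ℝ) : HasDerivAt bump (bumpDeriv s) s := by
  have h := ((hasDerivAt_pow 2 s).const_add 1).inv (one_add_sq_pos s).ne'
  convert! h using 1
  simp only [bumpDeriv, bump]
  have := (one_add_sq_pos s).ne'
  field_simp
  simp

theorem hasDerivAt_bumpDeriv (s : ℝ) : HasDerivAt bumpDeriv (bumpDeriv₂ s) s := by
  have h := (((hasDerivAt_id s).const_mul 2).neg).mul ((hasDerivAt_bump s).pow 2)
  convert! h using 1
  simp only [bumpDeriv₂, bumpDeriv, id]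
  have := one_add_sq_mul_bump s
  simp only [Pi.neg_apply, Pi.pow_apply]
  push_cast
  linear_combination (-2 * bump s ^ 2) * this

theorem hasDerivAt_hull (s : ℝ) : HasDerivAt hull (Real.arctan s) s := by
  have h := ((hasDerivAt_id s).mul (Real.hasDerivAt_arctan s)).sub
    ((((hasDerivAt_pow 2 s).const_add 1).log (one_add_sq_pos s).ne').div_const 2)
  convert! h using 1
  have := (one_add_sq_pos s).ne'
  simp only [id]
  field_simp
  push_cast
  ring

theorem hasDerivAt_arctan_bump (s : ℝ) : HasDerivAt Real.arctan (bump s) s := by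
  simpa [bump] using Real.hasDerivAt_arctan s

theorem abs_bumpDeriv_le (s : ℝ) : |bumpDeriv s| ≤ bump s := by
  have h0 := bump_pos s
  have h1 := one_add_sq_mul_bump s
  have h2 : |2 * s| ≤ 1 + s ^ 2 := abs_le.2 ⟨by nlinarith [sq_nonneg (s + 1)],
    by nlinarith [sq_nonneg (s - 1)]⟩
  rw [bumpDeriv, abs_mul, abs_neg, abs_of_nonneg (sq_nonneg (bump s))]
  calc |2 * s| * bump s ^ 2 ≤ (1 + s ^ 2) * bump s ^ 2 := by gcongr
    _ = bump s := by linear_combination bump s * h1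

theorem abs_bumpDeriv₂_le (s : ℝ) : |bumpDeriv₂ s| ≤ 6 * bump s := by
  have h0 := bump_pos s
  have h1 := one_add_sq_mul_bump s
  have h2 : |6 * s ^ 2 - 2| ≤ 6 * (1 + s ^ 2) ^ 2 := abs_le.2 ⟨by nlinarith [sq_nonneg s],
    by nlinarith [sq_nonneg s, sq_nonneg (s ^ 2)]⟩
  rw [bumpDeriv₂, abs_mul, abs_of_nonneg (pow_nonneg h0.le 3)]
  calc |6 * s ^ 2 - 2| * bump s ^ 3 ≤ 6 * (1 + s ^ 2) ^ 2 * bump s ^ 3 := by gcongr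
    _ = 6 * bump s * ((1 + s ^ 2) * bump s) ^ 2 := by ring
    _ = 6 * bump s := by rw [h1]; ring

/-- The constant `7 = 6 + 1` is the source of the coefficient of `hull` in `model`. -/
theorem abs_bumpDeriv₂_sub_le (s : ℝ) : |bumpDeriv₂ s - bump s| ≤ 7 * bump s := by
  have := abs_sub (bumpDeriv₂ s) (bump s)
  rw [abs_of_pos (bump_pos s)] at this
  linarith [abs_bumpDeriv₂_le s]

theorem abs_arctan_le_two (s : ℝ) : |Real.arctan s| ≤ 2 :=
  abs_le.2 ⟨by linarith [Real.neg_pi_div_two_lt_arctan s, Real.pi_le_four],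
    by linarith [Real.arctan_lt_pi_div_two s, Real.pi_le_four]⟩

theorem abs_sub_le_of_abs_deriv_le {f f' : ℝ → ℝ} (hf : ∀ s, HasDerivAt f (f' s) s) {C : ℝ}
    (hC : ∀ s, |f' s| ≤ C) (s t : ℝ) : |f s - f t| ≤ C * |s - t| := by
  simpa using convex_univ.norm_image_sub_le_of_norm_hasDerivWithin_le
    (fun x _ => (hf x).hasDerivWithinAt) (fun x _ => hC x) (Set.mem_univ t) (Set.mem_univ s)

/-- The superharmonic model `bump(s) cos t - 7 hull(s)`. -/
def model (s t : ℝ) : ℝ := bump s * Real.cos t - 7 * hull s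

/-- The partial derivative of `model` in the first variable. -/
def model₁ (s t : ℝ) : ℝ := bumpDeriv s * Real.cos t - 7 * Real.arctan s

/-- The partial derivative of `model` in the second variable. -/
def model₂ (s t : ℝ) : ℝ := -(bump s * Real.sin t)

/-- The second partial derivative of `model` in the first variable. -/
def model₁₁ (s t : ℝ) : ℝ := bumpDeriv₂ s * Real.cos t - 7 * bump s

/-- The mixed second partial derivative of `model`. -/
def model₁₂ (s t : ℝ) : ℝ := -(bumpDeriv s * Real.sin t)

/-- The second partial derivative of `model` in the second variable. -/
def model₂₂ (s t : ℝ) : ℝ := -(bump s * Real.cos t)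

theorem hasDerivAt_model_fst (s t : ℝ) : HasDerivAt (fun s => model s t) (model₁ s t) s :=
  ((hasDerivAt_bump s).mul_const _).sub ((hasDerivAt_hull s).const_mul 7)

theorem hasDerivAt_model_snd (s t : ℝ) : HasDerivAt (fun t => model s t) (model₂ s t) t := by
  simpa [model₂, model] using ((Real.hasDerivAt_cos t).const_mul (bump s)).sub_const (7 * hull s)

theorem hasDerivAt_model₁_fst (s t : ℝ) : HasDerivAt (fun s => model₁ s t) (model₁₁ s t) s :=
  ((hasDerivAt_bumpDeriv s).mul_const _).sub ((hasDerivAt_arctan_bump s).const_mul 7)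

theorem hasDerivAt_model₁_snd (s t : ℝ) : HasDerivAt (fun t => model₁ s t) (model₁₂ s t) t := by
  simpa [model₁₂, model₁] using
    ((Real.hasDerivAt_cos t).const_mul (bumpDeriv s)).sub_const (7 * Real.arctan s)

theorem hasDerivAt_model₂_fst (s t : ℝ) : HasDerivAt (fun s => model₂ s t) (model₁₂ s t) s :=
  ((hasDerivAt_bump s).mul_const _).neg

theorem hasDerivAt_model₂_snd (s t : ℝ) : HasDerivAt (fun t => model₂ s t) (model₂₂ s t) t :=
  ((Real.hasDerivAt_sin t).const_mul (bump s)).neg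

theorem abs_mul_le_of_abs_le_one {a b C : ℝ} (ha : |a| ≤ C) (hb : |b| ≤ 1) : |a * b| ≤ C := by
  rw [abs_mul]
  nlinarith [abs_nonneg a, abs_nonneg b]

theorem abs_bump_le (s : ℝ) : |bump s| ≤ bump s := (abs_of_pos (bump_pos s)).le

/-- `15 = 1 + 7 · 2`, from `|bump'| ≤ 1` and `|arctan| ≤ 2`. -/
theorem abs_model₁_le (s t : ℝ) : |model₁ s t| ≤ 15 := by
  have h1 := abs_mul_le_of_abs_le_one (abs_bumpDeriv_le s) (Real.abs_cos_le_one t)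
  have h2 := abs_arctan_le_two s
  have h3 := bump_le_one s
  rw [abs_le] at *
  unfold model₁
  constructor <;> linarith

theorem abs_model₂_le (s t : ℝ) : |model₂ s t| ≤ 1 := by
  rw [model₂, abs_neg]
  exact (abs_mul_le_of_abs_le_one (abs_bump_le s) (Real.abs_sin_le_one t)).trans (bump_le_one s)

/-- `13 = 6 + 7`; the other second derivatives are given the same constant so that one bound covers
the whole Hessian. -/
theorem abs_model₁₁_le (s t : ℝ) : |model₁₁ s t| ≤ 13 * bump s := by
  have h1 := abs_mul_le_of_abs_le_one (abs_bumpDeriv₂_le s) (Real.abs_cos_le_one t)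
  have h3 := bump_pos s
  rw [abs_le] at *
  unfold model₁₁
  constructor <;> linarith

theorem abs_model₁₂_le (s t : ℝ) : |model₁₂ s t| ≤ 13 * bump s := by
  rw [model₁₂, abs_neg]
  have := abs_mul_le_of_abs_le_one (abs_bumpDeriv_le s) (Real.abs_sin_le_one t)
  linarith [bump_pos s]

theorem abs_model₂₂_le (s t : ℝ) : |model₂₂ s t| ≤ 13 * bump s := by
  rw [model₂₂, abs_neg]
  have := abs_mul_le_of_abs_le_one (abs_bump_le s) (Real.abs_cos_le_one t)
  linarith [bump_pos s]

/-- The Laplacian is `(bump'' - bump) cos t - 7 bump`, and the first term is at most `7 bump`. -/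
theorem model_laplacian_nonpos (s t : ℝ) : model₁₁ s t + model₂₂ s t ≤ 0 := by
  have := abs_mul_le_of_abs_le_one (abs_bumpDeriv₂_sub_le s) (Real.abs_cos_le_one t)
  rw [abs_le] at this
  unfold model₁₁ model₂₂
  linarith [this.2]

theorem abs_model_sub_le (s t s' t' : ℝ) :
    |model s t - model s' t'| ≤ 15 * |s - s'| + |t - t'| := by
  have h1 := abs_sub_le_of_abs_deriv_le (fun s => hasDerivAt_model_fst s t)
    (fun s => abs_model₁_le s t) s s'
  have h2 := abs_sub_le_of_abs_deriv_le (fun t => hasDerivAt_model_snd s' t)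
    (fun t => abs_model₂_le s' t) t t'
  calc |model s t - model s' t'|
      = |(model s t - model s' t) + (model s' t - model s' t')| := by ring_nf
    _ ≤ _ := (abs_add_le _ _).trans (by linarith)

theorem model_zero : model 0 0 = 1 := by simp [model, bump, hull]

theorem continuous_hull : Continuous hull :=
  continuous_iff_continuousAt.2 fun s => (hasDerivAt_hull s).continuousAt

/-! ### Lifting the model to two coordinates of `ℝⁿ`. -/

variable {n : ℕ}

local notation "E" => EuclideanSpace ℝ (Fin n)

/-- The function `x ↦ c K(ν xᵢ, ν xⱼ)`. -/
def lift (c ν : ℝ) (i j : Fin n) (K : ℝ → ℝ → ℝ) (x : E) : ℝ := c * K (ν * x i) (ν * x j)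

/-- The `l`-th entry of the vector with entries `A` at `i`, `B` at `j`, and zero elsewhere. -/
def entry (i j l : Fin n) (A B : ℝ → ℝ → ℝ) : ℝ → ℝ → ℝ :=
  if l = i then A else if l = j then B else fun _ _ => 0

/-- The entries of the gradient of the model, viewed as a function of `xᵢ` and `xⱼ`. -/
def modelGrad (i j l : Fin n) : ℝ → ℝ → ℝ := entry i j l model₁ model₂

/-- The entries of the Hessian of the model, viewed as a function of `xᵢ` and `xⱼ`. -/
def modelHess (i j l m : Fin n) : ℝ → ℝ → ℝ :=
  entry i j l (entry i j m model₁₁ model₁₂) (entry i j m model₁₂ model₂₂)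

theorem modelHess_comm (i j l m : Fin n) : modelHess i j l m = modelHess i j m l := by
  unfold modelHess entry
  split_ifs <;> rfl

theorem continuous_lift (c ν : ℝ) (i j : Fin n) {K : ℝ → ℝ → ℝ}
    (hK : Continuous fun z : ℝ × ℝ => K z.1 z.2) : Continuous (lift c ν i j K) := by
  have h : Continuous fun x : E => (ν * x i, ν * x j) := by fun_prop
  exact continuous_const.mul (hK.comp h)

theorem continuous_entry (i j l : Fin n) {A B : ℝ → ℝ → ℝ}
    (hA : Continuous fun z : ℝ × ℝ => A z.1 z.2) (hB : Continuous fun z : ℝ × ℝ => B z.1 z.2) :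
    Continuous fun z : ℝ × ℝ => entry i j l A B z.1 z.2 := by
  unfold entry
  split_ifs
  exacts [hA, hB, continuous_const]

theorem continuous_model : Continuous fun z : ℝ × ℝ => model z.1 z.2 := by
  unfold model
  have := continuous_bump; have := continuous_hull
  fun_prop

theorem continuous_modelGrad (i j l : Fin n) :
    Continuous fun z : ℝ × ℝ => modelGrad i j l z.1 z.2 := by
  have := continuous_bump; have := continuous_bumpDeriv; have := Real.continuous_arctan
  refine continuous_entry i j l ?_ ?_
  · unfold model₁; fun_prop
  · unfold model₂; fun_prop

theorem continuous_modelHess (i j l m : Fin n) :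
    Continuous fun z : ℝ × ℝ => modelHess i j l m z.1 z.2 := by
  have := continuous_bump; have := continuous_bumpDeriv; have := continuous_bumpDeriv₂
  have h12 : Continuous fun z : ℝ × ℝ => model₁₂ z.1 z.2 := by unfold model₁₂; fun_prop
  refine continuous_entry i j l (continuous_entry i j m ?_ h12) (continuous_entry i j m h12 ?_)
  · unfold model₁₁; fun_prop
  · unfold model₂₂; fun_prop

/-- Chain rule: each derivative costs a factor `ν`. As `i ≠ j`, a move along one axis changes at
most one argument of `K`. -/
theorem hasLineDerivAt_lift (c ν : ℝ) {i j : Fin n} (hij : i ≠ j) {K A B : ℝ → ℝ → ℝ}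
    (hA : ∀ s t, HasDerivAt (fun s => K s t) (A s t) s)
    (hB : ∀ s t, HasDerivAt (fun t => K s t) (B s t) t) (l : Fin n) (x : E) :
    HasLineDerivAt ℝ (lift c ν i j K) (lift (c * ν) ν i j (entry i j l A B) x) x
      (EuclideanSpace.single l 1) := by
  have haff : ∀ y : ℝ, HasDerivAt (fun τ : ℝ => ν * (y + τ)) ν 0 := fun y => by
    simpa using ((hasDerivAt_id (0 : ℝ)).const_add y).const_mul ν
  unfold HasLineDerivAt lift entry
  by_cases hi : l = i
  · subst hi
    have h : HasDerivAt (fun τ => c * K (ν * (x l + τ)) (ν * x j))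
        (c * (A (ν * x l) (ν * x j) * ν)) 0 := by
      refine HasDerivAt.const_mul c (HasDerivAt.comp (0 : ℝ)
        (h₂ := fun s => K s (ν * x j)) (h := fun τ => ν * (x l + τ)) ?_ (haff (x l)))
      simpa using hA (ν * x l) (ν * x j)
    convert! h using 1
    · funext τ; simp [hij.symm]
    · simp; ring
  by_cases hj : l = j
  · subst hj
    have h : HasDerivAt (fun τ => c * K (ν * x i) (ν * (x l + τ)))
        (c * (B (ν * x i) (ν * x l) * ν)) 0 := by
      refine HasDerivAt.const_mul c (HasDerivAt.comp (0 : ℝ)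
        (h₂ := fun t => K (ν * x i) t) (h := fun τ => ν * (x l + τ)) ?_ (haff (x l)))
      simpa using hB (ν * x i) (ν * x l)
    convert! h using 1
    · funext τ; simp [hij]
    · simp [hi]; ring
  · have h := hasDerivAt_const (0 : ℝ) (c * K (ν * x i) (ν * x j))
    convert! h using 1
    · funext τ; simp [Ne.symm hi, Ne.symm hj]
    · simp [hi, hj]

theorem hasWeakPartial_lift_model (Ω : Set E) (c ν : ℝ) {i j : Fin n} (hij : i ≠ j) (l : Fin n) :
    HasWeakPartial Ω l (lift c ν i j model) (lift (c * ν) ν i j (modelGrad i j l)) :=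
  .of_hasLineDerivAt (continuous_lift _ _ _ _ continuous_model)
    (continuous_lift _ _ _ _ (continuous_modelGrad i j l))
    (hasLineDerivAt_lift c ν hij hasDerivAt_model_fst hasDerivAt_model_snd l)

theorem hasWeakPartial_lift_modelGrad (Ω : Set E) (c ν : ℝ) {i j : Fin n} (hij : i ≠ j)
    (l m : Fin n) :
    HasWeakPartial Ω m (lift c ν i j (modelGrad i j l))
      (lift (c * ν) ν i j (modelHess i j l m)) := by
  refine .of_hasLineDerivAt (continuous_lift _ _ _ _ (continuous_modelGrad i j l))
    (continuous_lift _ _ _ _ (continuous_modelHess i j l m)) fun x => ?_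
  unfold modelGrad modelHess
  by_cases hi : l = i
  · simpa only [entry, if_pos hi] using
      hasLineDerivAt_lift c ν hij hasDerivAt_model₁_fst hasDerivAt_model₁_snd m x
  by_cases hj : l = j
  · simpa only [entry, if_neg hi, if_pos hj] using
      hasLineDerivAt_lift c ν hij hasDerivAt_model₂_fst hasDerivAt_model₂_snd m x
  · have h := hasLineDerivAt_lift c ν hij (K := fun _ _ => 0) (A := fun _ _ => 0)
      (B := fun _ _ => 0) (fun s t => hasDerivAt_const s 0) (fun s t => hasDerivAt_const t 0) m x
    simpa only [entry, if_neg hi, if_neg hj, ite_self] using h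

theorem abs_modelGrad_le (i j l : Fin n) (s t : ℝ) : |modelGrad i j l s t| ≤ 15 := by
  unfold modelGrad entry
  split_ifs
  · exact abs_model₁_le s t
  · linarith [abs_model₂_le s t]
  · simp

theorem abs_modelHess_le (i j l m : Fin n) (s t : ℝ) : |modelHess i j l m s t| ≤ 13 * bump s := by
  have h0 : |(0 : ℝ)| ≤ 13 * bump s := by simpa using (bump_pos s).le
  unfold modelHess entry
  split_ifs
  exacts [abs_model₁₁_le s t, abs_model₁₂_le s t, h0, abs_model₁₂_le s t, abs_model₂₂_le s t,
    h0, h0]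

theorem sum_modelHess_nonpos {i j : Fin n} (hij : i ≠ j) (s t : ℝ) :
    ∑ l, modelHess i j l l s t ≤ 0 := by
  have : ∑ l, modelHess i j l l s t = modelHess i j i i s t + modelHess i j j j s t := by
    refine Fintype.sum_eq_add i j hij fun l hl => ?_
    simp [modelHess, entry, hl.1, hl.2]
  rw [this]
  simpa [modelHess, entry, hij.symm] using model_laplacian_nonpos s t

end Oscillation

/-! ### Integrals over boxes, orthogonality of cosines, and Hölder's inequality. -/

section Boxes

variable {n : ℕ}

local notation "E" => EuclideanSpace ℝ (Fin n)

theorem integral_prod_coordinates (φ : Fin n → ℝ → ℝ) :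
    ∫ x : E, ∏ l, φ l (x l) = ∏ l, ∫ t, φ l t := by
  rw [← integral_fintype_prod_volume_eq_prod]
  exact (PiLp.volume_preserving_ofLp (Fin n)).integral_comp
    (MeasurableEquiv.toLp 2 (Fin n → ℝ)).symm.measurableEmbedding fun y => ∏ l, φ l (y l)

theorem integrable_prod_coordinates {φ : Fin n → ℝ → ℝ} (hφ : ∀ l, Integrable (φ l)) :
    Integrable fun x : E => ∏ l, φ l (x l) :=
  (PiLp.volume_preserving_ofLp (Fin n)).integrable_comp_of_integrable
    (g := fun y : Fin n → ℝ => ∏ l, φ l (y l)) (Integrable.fintype_prod hφ)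

/-- The closed box with half side lengths `ρ`. -/
def box (ρ : Fin n → ℝ) : Set E := {x | ∀ l, x l ∈ Set.Icc (-ρ l) (ρ l)}

theorem measurableSet_box (ρ : Fin n → ℝ) : MeasurableSet (box ρ) := by
  have : box ρ = ⋂ l, (fun x : E => x l) ⁻¹' Set.Icc (-ρ l) (ρ l) := by ext; simp [box]
  rw [this]
  exact MeasurableSet.iInter fun l => measurableSet_Icc.preimage (by fun_prop)

theorem setIntegral_box (ρ : Fin n → ℝ) (φ : Fin n → ℝ → ℝ) :
    ∫ x in box ρ, ∏ l, φ l (x l) = ∏ l, ∫ t in Set.Icc (-ρ l) (ρ l), φ l t := by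
  simp_rw [← integral_indicator measurableSet_Icc]
  rw [← integral_prod_coordinates, ← integral_indicator (measurableSet_box ρ)]
  congr 1
  funext x
  by_cases hx : x ∈ box ρ
  · rw [Set.indicator_of_mem hx]
    exact Finset.prod_congr rfl fun l _ => (Set.indicator_of_mem (hx l) _).symm
  · rw [Set.indicator_of_notMem hx]
    simp only [box, Set.mem_ofPred_eq, not_forall] at hx
    obtain ⟨l, hl⟩ := hx
    exact (Finset.prod_eq_zero (Finset.mem_univ l) (Set.indicator_of_notMem hl _)).symm

theorem volume_box {ρ : Fin n → ℝ} (hρ : ∀ l, 0 ≤ ρ l) :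
    volume (box ρ) = ENNReal.ofReal (∏ l, 2 * ρ l) := by
  have : box ρ = (WithLp.ofLp : E → Fin n → ℝ) ⁻¹'
      (Set.univ.pi fun l => Set.Icc (-ρ l) (ρ l)) := by
    ext; simp only [box, Set.mem_preimage, Set.mem_univ_pi]; rfl
  rw [this, (PiLp.volume_preserving_ofLp (Fin n)).measure_preimage
    (MeasurableSet.univ_pi fun l => measurableSet_Icc).nullMeasurableSet, volume_pi_pi,
    ENNReal.ofReal_prod_of_nonneg fun l _ => by linarith [hρ l]]
  refine Finset.prod_congr rfl fun l _ => ?_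
  rw [Real.volume_Icc]
  congr 1; ring

/-- Half sides at most `1/n` give `|x|² ≤ n · (1/n)² = 1/n < 1`. -/
theorem box_subset_ball (hn : 2 ≤ n) {ρ : Fin n → ℝ} (hρ : ∀ l, ρ l ≤ 1 / n) :
    box ρ ⊆ ball (0 : E) 1 := by
  intro x hx
  have hn0 : (2 : ℝ) ≤ n := by exact_mod_cast hn
  rw [mem_ball_zero_iff, ← sq_lt_one_iff₀ (norm_nonneg x), EuclideanSpace.norm_sq_eq]
  calc ∑ l, ‖x l‖ ^ 2 ≤ ∑ _l : Fin n, (1 / n : ℝ) ^ 2 := by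
        refine Finset.sum_le_sum fun l _ => ?_
        have h := hx l
        have : ‖x l‖ ≤ 1 / n := (abs_le.2 ⟨h.1, h.2⟩).trans (hρ l)
        gcongr
    _ = 1 / n := by
        rw [Finset.sum_const, Finset.card_univ, Fintype.card_fin, nsmul_eq_mul]
        field_simp
    _ < 1 := by rw [div_lt_one (by linarith)]; linarith

/-- The multiple `z` is an integer, possibly negative, because it will be applied to differences of
frequencies. -/
theorem integral_cos_eq_zero {ν r : ℝ} {z : ℤ} (hz : z ≠ 0) (h : ν * r = z * Real.pi) :
    ∫ t in (-r)..r, Real.cos (ν * t) = 0 := by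
  have hν : ν ≠ 0 := by
    rintro rfl
    have : (z : ℝ) * Real.pi = 0 := by rw [← h, zero_mul]
    simp [hz, Real.pi_ne_zero] at this
  rw [intervalIntegral.integral_comp_mul_left _ hν, integral_cos, mul_neg, h, Real.sin_neg,
    Real.sin_int_mul_pi]
  simp

/-- Product to sum leaves the frequencies `N`, `N - N'` and `N + N'`, all nonzero. -/
theorem integral_cos_mul_one_sub_cos {r : ℝ} {ν ν' : ℝ} {N N' : ℕ} (hN : N ≠ 0)
    (h : ν * r = N * Real.pi) (h' : ν' * r = N' * Real.pi) (hne : N ≠ N') :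
    ∫ t in (-r)..r, Real.cos (ν * t) * (1 - Real.cos (ν' * t)) = 0 := by
  have e : ∀ t, Real.cos (ν * t) * (1 - Real.cos (ν' * t)) = Real.cos (ν * t)
      - (Real.cos ((ν - ν') * t) / 2 + Real.cos ((ν + ν') * t) / 2) := fun t => by
    rw [sub_mul, add_mul, Real.cos_sub, Real.cos_add]; ring
  simp only [e]
  rw [intervalIntegral.integral_sub, intervalIntegral.integral_add,
    intervalIntegral.integral_div, intervalIntegral.integral_div,
    integral_cos_eq_zero (z := N) (by exact_mod_cast hN) (by exact_mod_cast h),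
    integral_cos_eq_zero (z := (N : ℤ) - N') (by omega) (by push_cast; linarith),
    integral_cos_eq_zero (z := (N : ℤ) + N') (by omega) (by push_cast; linarith)]
  · simp
  all_goals exact Continuous.intervalIntegrable (by fun_prop) _ _

/-- Only the mean `1/2` of `cos²` survives, over an interval of length `2r`. -/
theorem integral_cos_mul_one_sub_cos_self {r : ℝ} {ν : ℝ} {N : ℕ} (hN : N ≠ 0)
    (h : ν * r = N * Real.pi) :
    ∫ t in (-r)..r, Real.cos (ν * t) * (1 - Real.cos (ν * t)) = -r := by
  have e : ∀ t, Real.cos (ν * t) * (1 - Real.cos (ν * t)) = Real.cos (ν * t)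
      - (1 / 2 + Real.cos ((ν + ν) * t) / 2) := fun t => by
    rw [add_mul, Real.cos_add]
    linear_combination (-1 / 2 : ℝ) * Real.sin_sq_add_cos_sq (ν * t)
  simp only [e]
  rw [intervalIntegral.integral_sub, intervalIntegral.integral_add,
    intervalIntegral.integral_const, intervalIntegral.integral_div,
    integral_cos_eq_zero (z := N) (by exact_mod_cast hN) (by exact_mod_cast h),
    integral_cos_eq_zero (z := (N : ℤ) + N) (by omega) (by push_cast; linarith)]
  · simp only [smul_eq_mul]; ring
  all_goals exact Continuous.intervalIntegrable (by fun_prop) _ _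

/-- A quadratic exponent beats a linear one: once `m θ ≥ 2` the power is at most `4^{-m}`, and `D <
2^m` absorbs the constant. This is what the exponent `k²` in `freq` is for. -/
theorem exists_pow_mul_rpow_lt {θ : ℝ} (hθ : 0 < θ) (D : ℝ) :
    ∃ m : ℕ, D * ((2 : ℝ) ^ (m ^ 2))⁻¹ ^ θ < (1 / 2 : ℝ) ^ m := by
  obtain ⟨m₁, hm₁⟩ := exists_nat_ge (2 / θ)
  obtain ⟨m₂, hm₂⟩ := pow_unbounded_of_one_lt D (one_lt_two : (1 : ℝ) < 2)
  set m := max m₁ m₂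
  have h1 : 2 ≤ m * θ := by
    have : (m₁ : ℝ) ≤ m := by exact_mod_cast le_max_left m₁ m₂
    rw [div_le_iff₀ hθ] at hm₁
    nlinarith
  have h2 : D < (2 : ℝ) ^ m := hm₂.trans_le (pow_le_pow_right₀ one_le_two (le_max_right _ _))
  refine ⟨m, ?_⟩
  have h3 : ((2 : ℝ) ^ (m ^ 2))⁻¹ ^ θ ≤ (1 / 2 : ℝ) ^ m * (1 / 2 : ℝ) ^ m := by
    have e1 : ((2 : ℝ) ^ (m ^ 2))⁻¹ ^ θ = (1 / 2 : ℝ) ^ ((m : ℝ) * (m * θ)) := by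
      rw [← inv_pow, ← Real.rpow_natCast, ← Real.rpow_mul (by positivity), one_div]
      push_cast
      congr 1; ring
    have e2 : (1 / 2 : ℝ) ^ m * (1 / 2 : ℝ) ^ m = (1 / 2 : ℝ) ^ ((m : ℝ) * 2) := by
      rw [← pow_add, ← Real.rpow_natCast]
      push_cast
      congr 1; ring
    rw [e1, e2]
    exact Real.rpow_le_rpow_of_exponent_ge (by norm_num) (by norm_num) (by gcongr)
  have h4 : (0 : ℝ) < (1 / 2) ^ m := by positivity
  have h5 : (2 : ℝ) ^ m * (1 / 2 : ℝ) ^ m = 1 := by rw [← mul_pow]; norm_num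
  have h6 : (0 : ℝ) ≤ ((2 : ℝ) ^ (m ^ 2))⁻¹ ^ θ := by positivity
  rcases le_or_gt D 0 with hD | hD
  · exact (mul_nonpos_of_nonpos_of_nonneg hD h6).trans_lt h4
  · calc D * ((2 : ℝ) ^ (m ^ 2))⁻¹ ^ θ ≤ D * ((1 / 2 : ℝ) ^ m * (1 / 2 : ℝ) ^ m) := by gcongr
      _ < (2 : ℝ) ^ m * ((1 / 2 : ℝ) ^ m * (1 / 2 : ℝ) ^ m) := by gcongr
      _ = (1 / 2 : ℝ) ^ m := by rw [← mul_assoc, h5, one_mul]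

/-- Hölder's inequality against an indicator function. -/
theorem integral_abs_le_of_memLp {α : Type*} [MeasurableSpace α] {μ : Measure α} {f : α → ℝ}
    {p : ℝ≥0∞} (hp : 1 < p) (hf : MemLp f p μ) {s : Set α} {v : ℝ} (hv : 0 ≤ v)
    (hs : μ s ≤ ENNReal.ofReal v) :
    ∫ x in s, |f x| ∂μ ≤ (eLpNorm f p μ).toReal * v ^ (1 - 1 / p.toReal) := by
  have hθ : 0 ≤ 1 - 1 / p.toReal := by
    -- For `p = ⊤`, `toReal` gives 0 and `1 / 0 = 0`, so the exponent is 1, as it should be.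
    rcases eq_or_ne p ⊤ with rfl | hpt
    · simp
    · have : 1 ≤ p.toReal := by
        rw [← ENNReal.toReal_one]; exact ENNReal.toReal_mono hpt hp.le
      rw [sub_nonneg]
      exact div_le_one_of_le₀ this (by positivity)
  have h := eLpNorm_le_eLpNorm_mul_rpow_measure_univ hp.le hf.1.restrict (μ := μ.restrict s)
  rw [Measure.restrict_apply_univ, ENNReal.toReal_one, div_one] at h
  have h2 : eLpNorm f 1 (μ.restrict s)
      ≤ eLpNorm f p μ * ENNReal.ofReal (v ^ (1 - 1 / p.toReal)) := by
    rw [← ENNReal.ofReal_rpow_of_nonneg hv hθ]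
    refine h.trans ?_
    gcongr
    exact Measure.restrict_le_self
  have h3 : ∫ x in s, |f x| ∂μ = (eLpNorm f 1 (μ.restrict s)).toReal := by
    rw [eLpNorm_one_eq_lintegral_enorm, ← integral_norm_eq_lintegral_enorm hf.1.restrict]
    rfl
  rw [h3, ← ENNReal.toReal_ofReal (Real.rpow_nonneg hv (1 - 1 / p.toReal)), ← ENNReal.toReal_mul]
  exact ENNReal.toReal_mono (ENNReal.mul_ne_top hf.2.ne ENNReal.ofReal_ne_top) h2

end Boxes

/-! ### The oscillating series: Lipschitz bound, weak derivatives, `W^{2,1}` regularity, minimality.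
-/

namespace Oscillation

variable {n : ℕ}

local notation "E" => EuclideanSpace ℝ (Fin n)

/-- The amplitudes of the oscillating series. -/
def amp (k : ℕ) : ℝ := (1 / 2) ^ k

/-- The frequencies of the oscillating series in dimension `n`. -/
def freq (n k : ℕ) : ℝ := Real.pi * n * 2 ^ k ^ 2

/-- The terms of the oscillating series. -/
def term (i j : Fin n) (k : ℕ) : E → ℝ := lift (amp k / freq n k) (freq n k) i j model

/-- The partial derivatives of the terms. -/
def termGrad (i j l : Fin n) (k : ℕ) : E → ℝ := lift (amp k) (freq n k) i j (modelGrad i j l)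

/-- The second partial derivatives of the terms. -/
def termHess (i j l m : Fin n) (k : ℕ) : E → ℝ :=
  lift (amp k * freq n k) (freq n k) i j (modelHess i j l m)

/-- The oscillating series. -/
def series (i j : Fin n) (x : E) : ℝ := ∑' k, term i j k x

/-- The gradient of the oscillating series. -/
def seriesGrad (i j : Fin n) (x : E) : E := WithLp.toLp 2 fun l => ∑' k, termGrad i j l k x

/-- The Hessian of the oscillating series. -/
def seriesHess (i j : Fin n) (x : E) : Matrix (Fin n) (Fin n) ℝ :=
  Matrix.of fun l m => ∑' k, termHess i j l m k x

theorem amp_pos (k : ℕ) : 0 < amp k := by unfold amp; positivity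

theorem summable_amp : Summable amp := summable_geometric_two

theorem natCast_le_freq (n k : ℕ) : (n : ℝ) ≤ freq n k := by
  have h1 : (1 : ℝ) ≤ 2 ^ k ^ 2 := one_le_pow₀ one_le_two
  have h2 : (1 : ℝ) ≤ Real.pi := by linarith [Real.pi_gt_three]
  calc (n : ℝ) = 1 * n * 1 := by ring
    _ ≤ freq n k := by unfold freq; gcongr

theorem one_le_freq (hn : 2 ≤ n) (k : ℕ) : 1 ≤ freq n k := by
  have : (2 : ℝ) ≤ n := by exact_mod_cast hn
  linarith [natCast_le_freq n k]

theorem freq_pos (hn : 2 ≤ n) (k : ℕ) : 0 < freq n k := one_pos.trans_le (one_le_freq hn k)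

/-- The factor `π n` in `freq` makes every frequency complete whole periods on `[-1/n, 1/n]`, as the
orthogonality relations require. -/
theorem freq_mul_inv (hn : 2 ≤ n) (k : ℕ) : freq n k * (1 / n) = (2 ^ k ^ 2 : ℕ) * Real.pi := by
  have : (n : ℝ) ≠ 0 := by positivity
  unfold freq
  push_cast
  field_simp

theorem continuous_term (i j : Fin n) (k : ℕ) : Continuous (term i j k) :=
  continuous_lift _ _ _ _ continuous_model

theorem continuous_termGrad (i j l : Fin n) (k : ℕ) : Continuous (termGrad i j l k) :=
  continuous_lift _ _ _ _ (continuous_modelGrad i j l)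

theorem continuous_termHess (i j l m : Fin n) (k : ℕ) : Continuous (termHess i j l m k) :=
  continuous_lift _ _ _ _ (continuous_modelHess i j l m)

theorem hasWeakPartial_term (hn : 2 ≤ n) (Ω : Set E) {i j : Fin n} (hij : i ≠ j) (l : Fin n)
    (k : ℕ) : HasWeakPartial Ω l (term i j k) (termGrad i j l k) := by
  have := hasWeakPartial_lift_model Ω (amp k / freq n k) (freq n k) hij l
  rwa [div_mul_cancel₀ _ (freq_pos hn k).ne'] at this

theorem hasWeakPartial_termGrad (Ω : Set E) {i j : Fin n} (hij : i ≠ j) (l m : Fin n) (k : ℕ) :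
    HasWeakPartial Ω m (termGrad i j l k) (termHess i j l m k) :=
  hasWeakPartial_lift_modelGrad Ω (amp k) (freq n k) hij l m

/-- The factor `1 / freq` cancels the frequency gained by differentiation; `16 = 15 + 1` adds the
bounds on the two partial derivatives. -/
theorem abs_term_sub_le (hn : 2 ≤ n) (i j : Fin n) (k : ℕ) (x y : E) :
    |term i j k x - term i j k y| ≤ amp k * (16 * ‖x - y‖) := by
  have hf := freq_pos hn k
  have ha := amp_pos k
  have h := abs_model_sub_le (freq n k * x i) (freq n k * x j) (freq n k * y i) (freq n k * y j)
  rw [← mul_sub, ← mul_sub, abs_mul, abs_mul, abs_of_pos hf] at h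
  have hi : |x i - y i| ≤ ‖x - y‖ := PiLp.norm_apply_le (x - y) i
  have hj : |x j - y j| ≤ ‖x - y‖ := PiLp.norm_apply_le (x - y) j
  unfold term lift
  rw [← mul_sub, abs_mul, abs_of_pos (div_pos ha hf)]
  calc amp k / freq n k * _
      ≤ amp k / freq n k * (15 * (freq n k * |x i - y i|) + freq n k * |x j - y j|) := by gcongr
    _ = amp k * (15 * |x i - y i| + |x j - y j|) := by field_simp
    _ ≤ amp k * (15 * ‖x - y‖ + ‖x - y‖) := by gcongr
    _ = amp k * (16 * ‖x - y‖) := by ring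

theorem abs_term_le (hn : 2 ≤ n) (i j : Fin n) (k : ℕ) (x : E) :
    |term i j k x| ≤ amp k * (1 + 16 * ‖x‖) := by
  have h := abs_term_sub_le hn i j k x 0
  have h0 : |term i j k 0| ≤ amp k := by
    simp only [term, lift, PiLp.zero_apply, mul_zero, model_zero, mul_one]
    rw [abs_of_pos (div_pos (amp_pos k) (freq_pos hn k))]
    exact div_le_self (amp_pos k).le (one_le_freq hn k)
  rw [sub_zero] at h
  have := abs_add_le (term i j k x - term i j k 0) (term i j k 0)
  rw [sub_add_cancel] at this
  linarith

theorem summable_term (hn : 2 ≤ n) (i j : Fin n) (x : E) : Summable fun k => term i j k x :=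
  Summable.of_norm_bounded (summable_amp.mul_right _) fun k => abs_term_le hn i j k x

theorem abs_series_sub_le (hn : 2 ≤ n) (i j : Fin n) (x y : E) :
    |series i j x - series i j y| ≤ (∑' k, amp k) * (16 * ‖x - y‖) := by
  unfold series
  rw [← (summable_term hn i j x).tsum_sub (summable_term hn i j y), ← tsum_mul_right]
  exact tsum_of_norm_bounded (f := fun k => term i j k x - term i j k y)
    (summable_amp.mul_right _).hasSum fun k => abs_term_sub_le hn i j k x y

theorem lipschitzWith_series (hn : 2 ≤ n) (i j : Fin n) :
    ∃ K : ℝ≥0, LipschitzWith K (series i j) := by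
  have h0 : 0 ≤ ∑' k, amp k := tsum_nonneg fun k => (amp_pos k).le
  refine ⟨NNReal.mk ((∑' k, amp k) * 16) (by positivity), LipschitzWith.of_dist_le_mul fun x y => ?_⟩
  rw [Real.dist_eq, dist_eq_norm, NNReal.coe_mk, mul_assoc]
  exact abs_series_sub_le hn i j x y

theorem abs_termGrad_le (i j l : Fin n) (k : ℕ) (x : E) : |termGrad i j l k x| ≤ amp k * 15 := by
  unfold termGrad lift
  rw [abs_mul, abs_of_pos (amp_pos k)]
  exact mul_le_mul_of_nonneg_left (abs_modelGrad_le _ _ _ _ _) (amp_pos k).le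

theorem abs_termHess_le (hn : 2 ≤ n) (i j l m : Fin n) (k : ℕ) (x : E) :
    |termHess i j l m k x| ≤ amp k * 13 * (freq n k * bump (freq n k * x i)) := by
  have h := mul_pos (amp_pos k) (freq_pos hn k)
  unfold termHess lift
  rw [abs_mul, abs_of_pos h]
  calc _ ≤ amp k * freq n k * (13 * bump (freq n k * x i)) :=
        mul_le_mul_of_nonneg_left (abs_modelHess_le _ _ _ _ _ _) h.le
    _ = _ := by ring

theorem integrable_bump : Integrable bump := integrable_inv_one_add_sq

/-- A rescaled bump in one coordinate has a bounded integral over the unit ball. -/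
theorem setIntegral_scaled_bump_le (i : Fin n) {ν : ℝ} (hν : 0 < ν) :
    ∫ x in ball (0 : E) 1, ν * bump (ν * x i) ≤ Real.pi * 2 ^ n := by
  -- The ball is enlarged to the product of the whole line in direction `i` and `[-1, 1]` in the
  -- others; the integral then factors, and `∫ ν bump(ν t) dt = π` for every `ν`.
  set φ : Fin n → ℝ → ℝ := fun l =>
    if l = i then fun t => ν * bump (ν * t) else (Set.Icc (-1) 1).indicator fun _ => 1
  have hφ0 : ∀ l t, 0 ≤ φ l t := fun l t => by
    simp only [φ]
    split_ifs
    · exact (mul_pos hν (bump_pos _)).le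
    · exact Set.indicator_nonneg (fun _ _ => zero_le_one) t
  have hφ : ∀ l, Integrable (φ l) := fun l => by
    simp only [φ]
    split_ifs
    · exact (integrable_bump.comp_mul_left' hν.ne').const_mul ν
    · exact (integrable_indicator_iff measurableSet_Icc).2 (integrableOn_const (by simp))
  have hint := integrable_prod_coordinates hφ
  have hle : ∀ x ∈ ball (0 : E) 1, ν * bump (ν * x i) ≤ ∏ l, φ l (x l) := fun x hx => by
    rw [Fintype.prod_eq_single i]
    · simp [φ]
    · intro l hl
      have h : |x l| ≤ 1 := (PiLp.norm_apply_le x l).trans (mem_ball_zero_iff.1 hx).le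
      simp only [φ, if_neg hl]
      exact Set.indicator_of_mem (s := Set.Icc (-1 : ℝ) 1) (f := fun _ => (1 : ℝ)) (abs_le.1 h)
  have hcont : Continuous fun x : E => ν * bump (ν * x i) := by
    have := continuous_bump; fun_prop
  calc ∫ x in ball (0 : E) 1, ν * bump (ν * x i)
      ≤ ∫ x in ball (0 : E) 1, ∏ l, φ l (x l) :=
        setIntegral_mono_on ((hcont.locallyIntegrable.integrableOn_isCompact
          (isCompact_closedBall 0 1)).mono_set ball_subset_closedBall) hint.integrableOn
          measurableSet_ball hle
    _ ≤ ∫ x : E, ∏ l, φ l (x l) := setIntegral_le_integral hint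
        (ae_of_all _ fun x => Finset.prod_nonneg fun l _ => hφ0 l _)
    _ = ∏ l, ∫ t, φ l t := integral_prod_coordinates φ
    _ = (∫ t, φ i t) * ∏ l ∈ Finset.univ.erase i, ∫ t, φ l t :=
        (Finset.mul_prod_erase _ _ (Finset.mem_univ i)).symm
    _ ≤ Real.pi * 2 ^ n := by
        have h1 : ∫ t, φ i t = Real.pi := by
          simp only [φ, if_true]
          rw [integral_const_mul, Measure.integral_comp_mul_left, smul_eq_mul, abs_of_pos
            (inv_pos.2 hν), ← mul_assoc, mul_inv_cancel₀ hν.ne', one_mul]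
          exact integral_univ_inv_one_add_sq
        have h2 : ∏ l ∈ Finset.univ.erase i, ∫ t, φ l t ≤ 2 ^ n := by
          have : ∀ l ∈ Finset.univ.erase i, ∫ t, φ l t = 2 := fun l hl => by
            simp only [φ, if_neg (Finset.ne_of_mem_erase hl)]
            rw [integral_indicator measurableSet_Icc]
            norm_num
          rw [Finset.prod_congr rfl this, Finset.prod_const]
          refine pow_le_pow_right₀ one_le_two ((Finset.card_le_univ _).trans ?_)
          simp
        rw [h1]
        exact mul_le_mul_of_nonneg_left h2 Real.pi_pos.le

theorem integrableOn_ball {f : E → ℝ} (hf : Continuous f) : IntegrableOn f (ball 0 1) volume :=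
  (hf.locallyIntegrable.integrableOn_isCompact
    (isCompact_closedBall 0 1)).mono_set ball_subset_closedBall

theorem summable_integral_of_bound {f : ℕ → E → ℝ} (hf : ∀ k, Continuous (f k)) {C : ℝ}
    (hC : ∀ k, ∀ x ∈ ball (0 : E) 1, |f k x| ≤ amp k * C) :
    Summable fun k => ∫ x in ball (0 : E) 1, |f k x| := by
  refine Summable.of_nonneg_of_le (fun k => integral_nonneg fun _ => abs_nonneg _) (fun k => ?_)
    (summable_amp.mul_right (C * (volume (ball (0 : E) 1)).toReal))
  calc ∫ x in ball (0 : E) 1, |f k x| ≤ ∫ _x in ball (0 : E) 1, amp k * C :=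
        setIntegral_mono_on (integrableOn_ball (hf k).abs) (integrableOn_const (by finiteness))
          measurableSet_ball (hC k)
    _ = _ := by rw [setIntegral_const, smul_eq_mul, measureReal_def]; ring

theorem summable_integral_term (hn : 2 ≤ n) (i j : Fin n) :
    Summable fun k => ∫ x in ball (0 : E) 1, |term i j k x| :=
  summable_integral_of_bound (C := 17) (continuous_term i j) fun k x hx => by
    refine (abs_term_le hn i j k x).trans (mul_le_mul_of_nonneg_left ?_ (amp_pos k).le)
    linarith [mem_ball_zero_iff.1 hx]

theorem summable_integral_termGrad (i j l : Fin n) :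
    Summable fun k => ∫ x in ball (0 : E) 1, |termGrad i j l k x| :=
  summable_integral_of_bound (continuous_termGrad i j l) fun k x _ => abs_termGrad_le i j l k x

/-- The `L¹` norm of `ν bump(ν xᵢ)` is bounded independently of `ν`, so the amplitudes alone ensure
convergence, however fast the frequencies grow. -/
theorem summable_integral_termHess (hn : 2 ≤ n) (i j l m : Fin n) :
    Summable fun k => ∫ x in ball (0 : E) 1, |termHess i j l m k x| := by
  refine Summable.of_nonneg_of_le (fun k => integral_nonneg fun _ => abs_nonneg _) (fun k => ?_)
    (summable_amp.mul_right (13 * (Real.pi * 2 ^ n)))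
  have hcont : Continuous fun x : E => amp k * 13 * (freq n k * bump (freq n k * x i)) := by
    have := continuous_bump; fun_prop
  calc ∫ x in ball (0 : E) 1, |termHess i j l m k x|
      ≤ ∫ x in ball (0 : E) 1, amp k * 13 * (freq n k * bump (freq n k * x i)) :=
        setIntegral_mono_on (integrableOn_ball (continuous_termHess i j l m k).abs)
          (integrableOn_ball hcont) measurableSet_ball fun x _ => abs_termHess_le hn i j l m k x
    _ ≤ amp k * 13 * (Real.pi * 2 ^ n) := by
        rw [integral_const_mul]
        exact mul_le_mul_of_nonneg_left (setIntegral_scaled_bump_le i (freq_pos hn k))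
          (by linarith [amp_pos k])
    _ = _ := by ring

theorem isWeakGradient_series (hn : 2 ≤ n) {i j : Fin n} (hij : i ≠ j) :
    IsWeakGradient (ball (0 : E) 1) (series i j) (seriesGrad i j) := fun l =>
  HasWeakPartial.tsum (fun k => hasWeakPartial_term hn _ hij l k)
    (fun k => integrableOn_ball (continuous_term i j k))
    (fun k => integrableOn_ball (continuous_termGrad i j l k))
    (summable_integral_term hn i j) (summable_integral_termGrad i j l)

theorem isWeakHessian_series (hn : 2 ≤ n) {i j : Fin n} (hij : i ≠ j) :
    IsWeakHessian (ball (0 : E) 1) (series i j) (seriesHess i j) :=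
  ⟨seriesGrad i j, isWeakGradient_series hn hij, fun l m =>
    HasWeakPartial.tsum (fun k => hasWeakPartial_termGrad _ hij l m k)
      (fun k => integrableOn_ball (continuous_termGrad i j l k))
      (fun k => integrableOn_ball (continuous_termHess i j l m k))
      (summable_integral_termGrad i j l) (summable_integral_termHess hn i j l m)⟩

/-- Needed because `matrixPosPart` vanishes on nonsymmetric matrices. -/
theorem isHermitian_seriesHess (i j : Fin n) (x : E) : (seriesHess i j x).IsHermitian := by
  ext l m
  simp [seriesHess, termHess, modelHess_comm i j l m]

instance : IsFiniteMeasure ((volume : Measure E).restrict (ball 0 1)) :=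
  isFiniteMeasure_restrict.2 measure_ball_lt_top.ne

theorem memLp_series (hn : 2 ≤ n) (i j : Fin n) (p : ℝ≥0∞) :
    MemLp (series i j) p (volume.restrict (ball (0 : E) 1)) := by
  obtain ⟨K, hK⟩ := lipschitzWith_series hn i j
  refine MemLp.of_bound hK.continuous.aestronglyMeasurable ((∑' k, amp k) * 17) ?_
  refine (ae_restrict_mem measurableSet_ball).mono fun x hx => ?_
  rw [← tsum_mul_right]
  refine tsum_of_norm_bounded (summable_amp.mul_right _).hasSum fun k =>
    (abs_term_le hn i j k x).trans (mul_le_mul_of_nonneg_left ?_ (amp_pos k).le)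
  linarith [mem_ball_zero_iff.1 hx]

theorem memLp_seriesGrad (i j : Fin n) (p : ℝ≥0∞) :
    MemLp (seriesGrad i j) p (volume.restrict (ball (0 : E) 1)) :=
  memLp_euclidean fun l =>
    MemLp.of_bound (integrable_tsum_of_summable_integral
      (fun k => integrableOn_ball (continuous_termGrad i j l k))
      (summable_integral_termGrad i j l)).1 ((∑' k, amp k) * 15) (ae_of_all _ fun x => by
        rw [← tsum_mul_right]
        exact tsum_of_norm_bounded (summable_amp.mul_right _).hasSum fun k =>
          abs_termGrad_le i j l k x)

theorem memW2_series (hn : 2 ≤ n) {i j : Fin n} (hij : i ≠ j) :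
    MemW2 1 (ball (0 : E) 1) (series i j) :=
  ⟨⟨memLp_series hn i j 1, _, isWeakGradient_series hn hij, memLp_seriesGrad i j 1⟩,
    _, isWeakHessian_series hn hij, memLp_matrix fun l m =>
      memLp_one_iff_integrable.2 (integrable_tsum_of_summable_integral
        (fun k => integrableOn_ball (continuous_termHess i j l m k))
        (summable_integral_termHess hn i j l m))⟩

theorem isObstacleSolution_series (hn : 2 ≤ n) {i j : Fin n} (hij : i ≠ j) :
    IsObstacleSolution (ball (0 : E) 1) (series i j) (series i j) (series i j) := by
  refine isObstacleSolution_of_series isOpen_ball (memLp_series hn i j 2)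
    (isWeakGradient_series hn hij) (memLp_seriesGrad i j 2)
    (F := fun k l => termGrad i j l k) (d := fun k l => termHess i j l l k)
    (c' := fun k => amp k * 13 * freq n k)
    (fun k l => hasWeakPartial_termGrad _ hij l l k)
    (fun k l => (continuous_termGrad i j l k).aestronglyMeasurable)
    (fun k l => (continuous_termHess i j l l k).aestronglyMeasurable)
    (summable_amp.mul_right 15) (fun k l x => abs_termGrad_le i j l k x)
    (fun k l x => (abs_termHess_le hn i j l l k x).trans ?_) (fun k x => ?_) fun l x => rfl
  · exact mul_le_mul_of_nonneg_left
      (mul_le_of_le_one_right (freq_pos hn k).le (bump_le_one _)) (by linarith [amp_pos k])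
  · simp only [termHess, lift, ← Finset.mul_sum]
    exact mul_nonpos_of_nonneg_of_nonpos (mul_pos (amp_pos k) (freq_pos hn k)).le
      (sum_modelHess_nonpos hij _ _)

/-! ### Testing `∂ⱼⱼ` on thin slabs, and failure of `L^p` integrability. -/

/-- Half side lengths of the `m`-th test slab, which is thin in the direction `i`. -/
def slab (i : Fin n) (m : ℕ) (l : Fin n) : ℝ := if l = i then 1 / freq n m else 1 / n

theorem slab_nonneg (hn : 2 ≤ n) (i : Fin n) (m : ℕ) (l : Fin n) : 0 ≤ slab i m l := by
  have := freq_pos hn m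
  unfold slab
  split_ifs <;> positivity

theorem slab_le (hn : 2 ≤ n) (i : Fin n) (m : ℕ) (l : Fin n) : slab i m l ≤ 1 / n := by
  have : (0 : ℝ) < n := by positivity
  unfold slab
  split_ifs
  · exact one_div_le_one_div_of_le this (natCast_le_freq n m)
  · exact le_rfl

theorem volume_slab_le (hn : 2 ≤ n) (i : Fin n) (m : ℕ) :
    volume (box (slab i m)) ≤ ENNReal.ofReal (2 ^ m ^ 2)⁻¹ := by
  rw [volume_box (slab_nonneg hn i m)]
  have hn0 : (2 : ℝ) ≤ n := by exact_mod_cast hn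
  refine ENNReal.ofReal_le_ofReal ?_
  rw [← Finset.mul_prod_erase _ _ (Finset.mem_univ i)]
  have h1 : ∏ l ∈ Finset.univ.erase i, 2 * slab i m l ≤ 1 := by
    refine Finset.prod_le_one (fun l _ => by linarith [slab_nonneg hn i m l]) fun l _ => ?_
    have : (1 : ℝ) / n ≤ 1 / 2 := one_div_le_one_div_of_le two_pos hn0
    linarith [slab_le hn i m l]
  have h2 : 2 * slab i m i ≤ (2 ^ m ^ 2)⁻¹ := by
    have hp : (2 : ℝ) ≤ Real.pi * n := by nlinarith [Real.pi_gt_three]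
    have h2 : (0 : ℝ) < 2 ^ m ^ 2 := by positivity
    simp only [slab, if_true, freq]
    rw [mul_one_div, div_le_iff₀ (by positivity)]
    field_simp
    exact hp
  calc _ ≤ ((2 : ℝ) ^ m ^ 2)⁻¹ * 1 :=
        mul_le_mul h2 h1 (Finset.prod_nonneg fun l _ => by linarith [slab_nonneg hn i m l])
          (by positivity)
    _ = _ := mul_one _

/-- The one-dimensional factors of `∂ⱼⱼ` of the `k`-th term against the `m`-th test weight. -/
def factor (i j : Fin n) (k m : ℕ) (l : Fin n) (t : ℝ) : ℝ :=
  if l = i then bump (freq n k * t)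
  else if l = j then Real.cos (freq n k * t) * (1 - Real.cos (freq n m * t)) else 1

theorem setIntegral_termHess {i j : Fin n} (hij : i ≠ j) (k m : ℕ) :
    ∫ x in box (slab i m), termHess i j j j k x * (1 - Real.cos (freq n m * x j))
      = -(amp k * freq n k) * ∏ l, ∫ t in Set.Icc (-slab i m l) (slab i m l),
        factor i j k m l t := by
  rw [← setIntegral_box, ← integral_const_mul]
  congr 1
  funext x
  have : ∏ l, factor i j k m l (x l) = factor i j k m i (x i) * factor i j k m j (x j) :=
    Fintype.prod_eq_mul i j hij fun l hl => by simp [factor, hl.1, hl.2]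
  rw [this]
  simp only [factor, if_true, if_neg hij.symm, termHess, lift, modelHess, entry, model₂₂]
  ring

theorem integral_Icc_eq (f : ℝ → ℝ) {r : ℝ} (hr : 0 ≤ r) :
    ∫ t in Set.Icc (-r) r, f t = ∫ t in (-r)..r, f t := by
  rw [intervalIntegral.integral_of_le (by linarith), integral_Icc_eq_integral_Ioc]

/-- The factor in the direction `j` vanishes by orthogonality, since `k ↦ 2^{k²}` is injective. -/
theorem setIntegral_termHess_of_ne (hn : 2 ≤ n) {i j : Fin n} (hij : i ≠ j) {k m : ℕ}
    (hkm : k ≠ m) :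
    ∫ x in box (slab i m), termHess i j j j k x * (1 - Real.cos (freq n m * x j)) = 0 := by
  rw [setIntegral_termHess hij]
  refine mul_eq_zero_of_right _ (Finset.prod_eq_zero (Finset.mem_univ j) ?_)
  rw [integral_Icc_eq _ (slab_nonneg hn i m j)]
  simp only [factor, slab, if_neg hij.symm, if_true]
  refine integral_cos_mul_one_sub_cos (by positivity) (freq_mul_inv hn k) (freq_mul_inv hn m) ?_
  intro h
  exact hkm (Nat.pow_left_injective (n := 2) (by norm_num) (Nat.pow_right_injective le_rfl h))

/-- The factor at `i` is at least `1/ν_m` (`bump ≥ 1/2` on an interval of length `2/ν_m`) and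
offsets the `ν_m` in front. The factor at `j` is `-1/n`, which cancels the minus sign of `∂ⱼⱼ`; each
of the others is `2/n`. -/
theorem le_setIntegral_termHess (hn : 2 ≤ n) {i j : Fin n} (hij : i ≠ j) (m : ℕ) :
    amp m * (1 / n) ^ n ≤
      ∫ x in box (slab i m), termHess i j j j m x * (1 - Real.cos (freq n m * x j)) := by
  have hf := freq_pos hn m
  have hn0 : (2 : ℝ) ≤ n := by exact_mod_cast hn
  have hnpos : (0 : ℝ) < 1 / n := by positivity
  have hn1 : (1 : ℝ) / n ≤ 1 := by rw [div_le_one (by linarith)]; linarith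
  set J : Fin n → ℝ := fun l => ∫ t in Set.Icc (-slab i m l) (slab i m l), factor i j m m l t
  have hJi : 1 / freq n m ≤ J i := by
    have hs : slab i m i = 1 / freq n m := by simp [slab]
    have hb : ∀ t ∈ Set.Icc (-(1 / freq n m)) (1 / freq n m),
        1 / 2 ≤ bump (freq n m * t) := fun t ht => by
      have h1 : |freq n m * t| ≤ 1 := by
        rw [abs_mul, abs_of_pos hf, mul_comm, ← le_div_iff₀ hf]
        exact abs_le.2 ht
      have h2 : (freq n m * t) ^ 2 ≤ 1 := (sq_le_one_iff_abs_le_one _).2 h1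
      unfold bump
      rw [one_div]
      exact inv_anti₀ (one_add_sq_pos _) (by linarith)
    have hc : Continuous fun t => bump (freq n m * t) := by
      have := continuous_bump; fun_prop
    calc 1 / freq n m = ∫ _t in Set.Icc (-(1 / freq n m)) (1 / freq n m), (1 / 2 : ℝ) := by
          rw [setIntegral_const, Real.volume_real_Icc_of_le (by linarith [one_div_pos.2 hf]),
            smul_eq_mul]
          ring
      _ ≤ ∫ t in Set.Icc (-(1 / freq n m)) (1 / freq n m), bump (freq n m * t) :=
          setIntegral_mono_on (integrableOn_const (by simp))
            hc.continuousOn.integrableOn_Icc measurableSet_Icc hb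
      _ = J i := by simp only [J, hs, factor, if_true]
  have hJj : J j = -(1 / n) := by
    simp only [J]
    rw [integral_Icc_eq _ (slab_nonneg hn i m j)]
    simp only [factor, slab, if_neg hij.symm, if_true]
    exact integral_cos_mul_one_sub_cos_self (by positivity) (freq_mul_inv hn m)
  have hJl : ∀ l ∈ (Finset.univ.erase i).erase j, 1 / n ≤ J l := fun l hl => by
    have hlj := Finset.ne_of_mem_erase hl
    have hli := Finset.ne_of_mem_erase (Finset.mem_of_mem_erase hl)
    simp only [J, factor, slab, if_neg hli, if_neg hlj]
    rw [setIntegral_const, Real.volume_real_Icc_of_le (by linarith), smul_eq_mul]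
    linarith
  have hprod : (1 / n : ℝ) ^ (n - 1) ≤ -(freq n m) * ∏ l, J l := by
    have hj : j ∈ Finset.univ.erase i := Finset.mem_erase.2 ⟨hij.symm, Finset.mem_univ j⟩
    rw [← Finset.mul_prod_erase _ _ (Finset.mem_univ i), ← Finset.mul_prod_erase _ _ hj, hJj]
    have hcard : ((Finset.univ.erase i).erase j).card = n - 2 := by
      rw [Finset.card_erase_of_mem hj, Finset.card_erase_of_mem (Finset.mem_univ i),
        Finset.card_univ, Fintype.card_fin]
      omega
    have h1 : (1 / n : ℝ) ^ (n - 2) ≤ ∏ l ∈ (Finset.univ.erase i).erase j, J l := by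
      rw [← hcard, ← Finset.prod_const]
      exact Finset.prod_le_prod (fun _ _ => hnpos.le) hJl
    have h2 : 1 ≤ freq n m * J i := by
      rw [mul_comm, ← div_le_iff₀ hf]; exact hJi
    calc (1 / n : ℝ) ^ (n - 1) = 1 * (1 / n * (1 / n : ℝ) ^ (n - 2)) := by
          rw [one_mul, ← pow_succ']
          congr 1; omega
      _ ≤ (freq n m * J i) * (1 / n * ∏ l ∈ (Finset.univ.erase i).erase j, J l) := by gcongr
      _ = _ := by ring
  rw [setIntegral_termHess hij]
  calc amp m * (1 / n : ℝ) ^ n ≤ amp m * (1 / n) ^ (n - 1) := by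
        refine mul_le_mul_of_nonneg_left ?_ (amp_pos m).le
        exact pow_le_pow_of_le_one hnpos.le hn1 (Nat.sub_le n 1)
    _ ≤ amp m * (-(freq n m) * ∏ l, J l) := mul_le_mul_of_nonneg_left hprod (amp_pos m).le
    _ = _ := by ring

theorem le_setIntegral_seriesHess (hn : 2 ≤ n) {i j : Fin n} (hij : i ≠ j) (m : ℕ) :
    amp m * (1 / n) ^ n ≤
      ∫ x in box (slab i m), seriesHess i j x j j * (1 - Real.cos (freq n m * x j)) := by
  have hsub : box (slab i m) ⊆ ball (0 : E) 1 := box_subset_ball hn (slab_le hn i m)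
  have hint := fun k => (integrableOn_ball (continuous_termHess i j j j k)).mono_set hsub
  have hs : Summable fun k => ∫ x in box (slab i m), |termHess i j j j k x| :=
    Summable.of_nonneg_of_le (fun k => integral_nonneg fun _ => abs_nonneg _)
      (fun k => setIntegral_mono_set (integrableOn_ball (continuous_termHess i j j j k)).abs
        (ae_of_all _ fun x => abs_nonneg _) hsub.eventuallyLE)
      (summable_integral_termHess hn i j j j)
  have hsum := hasSum_integral_mul_of_summable hint hs
    (ψ := fun x : E => 1 - Real.cos (freq n m * x j)) (C := 2)
    (Continuous.aestronglyMeasurable (by fun_prop)) fun x => by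
      have h1 := Real.neg_one_le_cos (freq n m * x j)
      have h2 := Real.cos_le_one (freq n m * x j)
      exact abs_le.2 ⟨by linarith, by linarith⟩
  have h1 := hasSum_single (f := fun k => ∫ x in box (slab i m),
    termHess i j j j k x * (1 - Real.cos (freq n m * x j))) m fun k hk =>
      setIntegral_termHess_of_ne hn hij hk
  exact (le_setIntegral_termHess hn hij m).trans_eq (h1.unique hsum)

/-- A function that dominates `∂ⱼⱼ` of the oscillating series is in no `L^p` with `p > 1`. -/
theorem not_memLp_of_seriesHess_le (hn : 2 ≤ n) {i j : Fin n} (hij : i ≠ j) {P : E → ℝ}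
    (hP : ∀ᵐ x ∂(volume.restrict (ball (0 : E) 1)), seriesHess i j x j j ≤ P x) {p : ℝ≥0∞}
    (hp : 1 < p) : ¬ MemLp P p (volume.restrict (ball (0 : E) 1)) := by
  intro hmem
  have hθ : 0 < 1 - 1 / p.toReal := by
    rcases eq_or_ne p ⊤ with rfl | hpt
    · simp
    · have : 1 < p.toReal := by
        rw [← ENNReal.toReal_one]; exact ENNReal.toReal_strict_mono hpt hp
      rw [sub_pos, div_lt_one (by linarith)]
      exact this
  set μ := volume.restrict (ball (0 : E) 1)
  set M := (eLpNorm P p μ).toReal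
  have hκ : (0 : ℝ) < (1 / n) ^ n := by positivity
  -- The constant is chosen so that twice the Hölder bound on the slab drops below the lower bound
  -- `2^{-m} (1/n)^n`.
  obtain ⟨m, hm⟩ := exists_pow_mul_rpow_lt hθ (2 * M / (1 / n : ℝ) ^ n)
  have hsub : box (slab i m) ⊆ ball (0 : E) 1 := box_subset_ball hn (slab_le hn i m)
  have hres : μ.restrict (box (slab i m)) = volume.restrict (box (slab i m)) := by
    rw [Measure.restrict_restrict (measurableSet_box _), Set.inter_eq_left.2 hsub]
  have hholder := integral_abs_le_of_memLp hp hmem (s := box (slab i m)) (v := (2 ^ m ^ 2)⁻¹)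
    (by positivity) ((Measure.restrict_apply_le _ _).trans (volume_slab_le hn i m))
  have hPint : Integrable P (μ.restrict (box (slab i m))) := (hmem.integrable hp.le).restrict
  have hHint : Integrable (fun x => seriesHess i j x j j) (μ.restrict (box (slab i m))) :=
    Integrable.restrict (integrable_tsum_of_summable_integral
      (fun k => integrableOn_ball (continuous_termHess i j j j k))
      (summable_integral_termHess hn i j j j))
  have hw : ∀ x : E, 0 ≤ 1 - Real.cos (freq n m * x j) ∧ 1 - Real.cos (freq n m * x j) ≤ 2 :=
    fun x => ⟨by linarith [Real.cos_le_one (freq n m * x j)],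
      by linarith [Real.neg_one_le_cos (freq n m * x j)]⟩
  -- Nonnegativity of the weight is what allows a one-sided bound on the Hessian entry; its maximum
  -- 2 gives the factor.
  have hup : ∫ x in box (slab i m), seriesHess i j x j j * (1 - Real.cos (freq n m * x j)) ∂μ
      ≤ ∫ x in box (slab i m), |P x| * 2 ∂μ := by
    refine integral_mono_ae (hHint.mul_bdd (c := 2)
      (Continuous.aestronglyMeasurable (by fun_prop)) (ae_of_all _ fun x => ?_))
      (hPint.abs.mul_const 2) ((ae_restrict_of_ae hP).mono fun x hx => ?_)
    · rw [Real.norm_eq_abs, abs_of_nonneg (hw x).1]; exact (hw x).2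
    · exact (mul_le_mul_of_nonneg_right (hx.trans (le_abs_self _)) (hw x).1).trans
        (mul_le_mul_of_nonneg_left (hw x).2 (abs_nonneg _))
  rw [hres] at hup hholder
  have hlow := le_setIntegral_seriesHess hn hij m
  rw [integral_mul_const] at hup
  rw [div_mul_eq_mul_div, div_lt_iff₀ hκ] at hm
  unfold amp at hlow
  linarith

end Oscillation

end ObstacleProblem

end

theorem proposition4p1 (n : ℕ) (hn : 2 ≤ n) :
    ∃ φ g u : EuclideanSpace ℝ (Fin n) → ℝ,
      (∃ K : ℝ≥0, LipschitzOnWith K φ (ball 0 1)) ∧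
      ObstacleProblem.IsObstacleSolution (ball 0 1) φ g u ∧
      u = φ ∧
      ObstacleProblem.MemW2 1 (ball 0 1) u ∧
      ∀ H : EuclideanSpace ℝ (Fin n) → Matrix (Fin n) (Fin n) ℝ,
        ObstacleProblem.IsWeakHessian (ball 0 1) u H →
        ∀ p : ℝ≥0∞, 1 < p →
          ¬ MemLp (fun x => ObstacleProblem.matrixPosPart (H x)) p
            (volume.restrict (ball (0 : EuclideanSpace ℝ (Fin n)) 1)) := by
  have hij : (⟨0, by omega⟩ : Fin n) ≠ ⟨1, by omega⟩ := by simp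
  set i : Fin n := ⟨0, by omega⟩
  set j : Fin n := ⟨1, by omega⟩
  refine ⟨_, _, ObstacleProblem.Oscillation.series i j, ?_,
    ObstacleProblem.Oscillation.isObstacleSolution_series hn hij, rfl,
    ObstacleProblem.Oscillation.memW2_series hn hij, fun H hH p hp hmem => ?_⟩
  · obtain ⟨K, hK⟩ := ObstacleProblem.Oscillation.lipschitzWith_series hn i j
    exact ⟨K, hK.lipschitzOnWith⟩
  · have hae := hH.ae_eq isOpen_ball (ObstacleProblem.Oscillation.isWeakHessian_series hn hij)
    refine ObstacleProblem.Oscillation.not_memLp_of_seriesHess_le hn hij (hae.mono fun x hx => ?_)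
      hp (ObstacleProblem.memLp_matrix_apply hmem j j)
    rw [hx]
    exact ObstacleProblem.le_matrixPosPart_apply
      (ObstacleProblem.Oscillation.isHermitian_seriesHess i j x) j
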